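/- Let $\mathcal O=\mathbb C\{x,y\}$ be the ring of convergent power series in two variables. For $f\in\mathcal O$ let $J_f=\langle \partial f/\partial x,\partial f/\partial y\rangle$, and put $\mu(f)=\dim_{\mathbb C}\mathcal O/J_f$ (Milnor number), $\tau(f)=\dim_{\mathbb C}\mathcal O/(\langle f\rangle+J_f)$ (Tjurina number) and $\rho(f)=\mu(f)/\tau(f)$. We say that $f$ defines an isolated plane curve singularity if $f$, $\partial f/\partial x$, $\partial f/\partial y$ all vanish at the origin and have no other common zero in some neighbourhood of it. There is a sequence of isolated plane curve singularities, with finite Milnor and Tjurina numbers, for which the sequence of rational numbers $\rho$ is strictly increasing with limit $4/3$. Moreover, the singularities can be chosen to be all irreducible, or all to consist of smooth branches with pairwise distinct tangents. More precisely: (a) For every integer $m\ge 2$ the series $f=x^{2m+1}+x^my^{m+1}+y^{2m}$ defines an isolated plane curve singularity and is irreducible in $\mathcal O$; the algebras $\mathcal O/J_f$ and $\mathcal O/(\langle f\rangle+J_f)$ are finite-dimensional, with $\tau(f)=3m^2$ and $\mu(f)=2m(2m-1)$. The numbers $\rho(f)$ are strictly increasing in $m\ge 2$ and tend to $4/3$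 as $m\to\infty$. (b) For every integer $m\ge 1$ the series $f=x^{2m+1}+y^{2m+1}+x^{m+1}y^{m+1}$ defines an isolated plane curve singularity all of whose branches are smooth, with pairwise distinct tangents (that is, up to a unit of $\mathcal O$, $f$ is a product of irreducible elements of $\mathcal O$ with nonzero gradients at the origin, pairwise linearly independent); the algebras $\mathcal O/J_f$ and $\mathcal O/(\langle f\rangle+J_f)$ are finite-dimensional, with $\mu(f)=4m^2$ and $\tau(f)=4m^2-(m-1)^2$. The numbers $\rho(f)$ are strictly increasing in $m\ge 1$ and tend to $4/3$ as $m\to\infty$. -/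

import Mathlib

open Filter Topology

namespace PlaneCurve

noncomputable section

/-- A formal power series `φ = ∑ aₙ x^{n₀} y^{n₁}` is convergent if it converges absolutely on
some polydisc of radius `r > 0` around the origin. -/
def IsConvergent (φ : MvPowerSeries (Fin 2) ℂ) : Prop :=
  ∃ r : ℝ, 0 < r ∧
    Summable fun n : Fin 2 →₀ ℕ => ‖MvPowerSeries.coeff n φ‖ * r ^ (n 0 + n 1)

lemma isConvergent_monomial (d : Fin 2 →₀ ℕ) (a : ℂ) :
    IsConvergent (MvPowerSeries.monomial d a) := by
  classical
  refine ⟨1, one_pos, summable_of_ne_finset_zero (s := {d}) ?_⟩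
  intro n hn
  have hnd : n ≠ d := by simpa using hn
  simp [MvPowerSeries.coeff_monomial, hnd]

lemma IsConvergent.smaller {φ : MvPowerSeries (Fin 2) ℂ} {r s : ℝ} (hs : 0 ≤ s) (hsr : s ≤ r)
    (h : Summable fun n : Fin 2 →₀ ℕ => ‖MvPowerSeries.coeff n φ‖ * r ^ (n 0 + n 1)) :
    Summable fun n : Fin 2 →₀ ℕ => ‖MvPowerSeries.coeff n φ‖ * s ^ (n 0 + n 1) := by
  refine Summable.of_nonneg_of_le (fun n => by positivity) (fun n => ?_) h
  gcongr

lemma IsConvergent.add {φ ψ : MvPowerSeries (Fin 2) ℂ} (hφ : IsConvergent φ)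
    (hψ : IsConvergent ψ) : IsConvergent (φ + ψ) := by
  obtain ⟨r, hr, h1⟩ := hφ
  obtain ⟨s, hs, h2⟩ := hψ
  have ht : 0 < min r s := lt_min hr hs
  refine ⟨min r s, ht, ?_⟩
  refine Summable.of_nonneg_of_le (fun n => by positivity) (fun n => ?_)
    ((IsConvergent.smaller ht.le (min_le_left r s) h1).add
      (IsConvergent.smaller ht.le (min_le_right r s) h2))
  rw [map_add, ← add_mul]
  gcongr
  exact norm_add_le _ _

lemma IsConvergent.mul {φ ψ : MvPowerSeries (Fin 2) ℂ} (hφ : IsConvergent φ)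
    (hψ : IsConvergent ψ) : IsConvergent (φ * ψ) := by
  classical
  obtain ⟨r, hr, h1⟩ := hφ
  obtain ⟨s, hs, h2⟩ := hψ
  have ht : 0 < min r s := lt_min hr hs
  refine ⟨min r s, ht, ?_⟩
  set t := min r s
  have h1' := IsConvergent.smaller ht.le (min_le_left r s) h1
  have h2' := IsConvergent.smaller ht.le (min_le_right r s) h2
  have h3 : Summable fun n : Fin 2 →₀ ℕ => ∑ p ∈ Finset.HasAntidiagonal.antidiagonal n,
      (‖MvPowerSeries.coeff p.1 φ‖ * t ^ (p.1 0 + p.1 1)) *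
        (‖MvPowerSeries.coeff p.2 ψ‖ * t ^ (p.2 0 + p.2 1)) := by
    refine summable_sum_mul_antidiagonal_of_summable_mul
      (f := fun n : Fin 2 →₀ ℕ => ‖MvPowerSeries.coeff n φ‖ * t ^ (n 0 + n 1))
      (g := fun n : Fin 2 →₀ ℕ => ‖MvPowerSeries.coeff n ψ‖ * t ^ (n 0 + n 1)) ?_
    exact Summable.mul_of_nonneg h1' h2' (fun n => by dsimp; positivity)
      (fun n => by dsimp; positivity)
  refine Summable.of_nonneg_of_le (fun n => by positivity) (fun n => ?_) h3
  rw [MvPowerSeries.coeff_mul]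
  refine (mul_le_mul_of_nonneg_right (norm_sum_le _ _) (by positivity)).trans ?_
  rw [Finset.sum_mul]
  refine Finset.sum_le_sum fun p hp => ?_
  have h0 : n 0 = p.1 0 + p.2 0 := by
    rw [← Finset.HasAntidiagonal.mem_antidiagonal.mp hp, Finsupp.add_apply]
  have h1 : n 1 = p.1 1 + p.2 1 := by
    rw [← Finset.HasAntidiagonal.mem_antidiagonal.mp hp, Finsupp.add_apply]
  rw [h0, h1, norm_mul]
  refine le_of_eq ?_
  ring

lemma IsConvergent.pderiv {φ : MvPowerSeries (Fin 2) ℂ} (hφ : IsConvergent φ) (i : Fin 2) :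
    IsConvergent (MvPowerSeries.pderiv ℂ i φ) := by
  obtain ⟨r, hr, h⟩ := hφ
  refine ⟨r / 2, by positivity, ?_⟩
  have hinj : Function.Injective fun n : Fin 2 →₀ ℕ => n + Finsupp.single i 1 :=
    fun a b hab => by simpa using hab
  have h2 := (h.comp_injective hinj).mul_left r⁻¹
  refine Summable.of_nonneg_of_le (fun n => by positivity) (fun n => ?_) h2
  have hdeg : (n + Finsupp.single i 1 : Fin 2 →₀ ℕ) 0 + (n + Finsupp.single i 1 : Fin 2 →₀ ℕ) 1
      = n 0 + n 1 + 1 := by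
    rw [Finsupp.add_apply, Finsupp.add_apply]
    fin_cases i
    · simp; omega
    · simp; omega
  have hle : (n i : ℝ) + 1 ≤ 2 ^ (n 0 + n 1) := by
    have h3 : n i + 1 ≤ n 0 + n 1 + 1 := by fin_cases i <;> simp
    have h4 : n i + 1 ≤ 2 ^ (n 0 + n 1) := h3.trans Nat.lt_two_pow_self
    exact_mod_cast h4
  simp only [Function.comp_apply]
  rw [hdeg, MvPowerSeries.coeff_pderiv, norm_mul]
  have hn : ‖((n i : ℂ) + 1)‖ = (n i : ℝ) + 1 := by
    rw [← Nat.cast_succ, Complex.norm_natCast, Nat.cast_succ]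
  rw [hn, div_pow, pow_succ]
  have e : r⁻¹ * (‖MvPowerSeries.coeff (n + Finsupp.single i 1) φ‖ * (r ^ (n 0 + n 1) * r))
      = ‖MvPowerSeries.coeff (n + Finsupp.single i 1) φ‖ * 2 ^ (n 0 + n 1)
        * (r ^ (n 0 + n 1) / 2 ^ (n 0 + n 1)) := by
    field_simp
  rw [e]
  gcongr

/-- The local ring `𝒪 = ℂ{x, y}` of germs at the origin of holomorphic functions on `ℂ²`,
as the ring of convergent power series in two variables. -/
def localRing : Subalgebra ℂ (MvPowerSeries (Fin 2) ℂ) where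
  carrier := {φ | IsConvergent φ}
  mul_mem' := fun h1 h2 => h1.mul h2
  add_mem' := fun h1 h2 => h1.add h2
  algebraMap_mem' := fun a => isConvergent_monomial 0 a

/-- The coordinate function `x`. -/
def x : localRing := ⟨MvPowerSeries.X 0, isConvergent_monomial _ 1⟩

/-- The coordinate function `y`. -/
def y : localRing := ⟨MvPowerSeries.X 1, isConvergent_monomial _ 1⟩

/-- The partial derivative of a germ: `∂ 0 = ∂/∂x`, `∂ 1 = ∂/∂y`. -/
def partialDeriv (i : Fin 2) (f : localRing) : localRing :=
  ⟨MvPowerSeries.pderiv ℂ i f.1, IsConvergent.pderiv f.2 i⟩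

/-- The value at the origin. -/
def valueAtZero (f : localRing) : ℂ := MvPowerSeries.constantCoeff f.1

/-- The sum of the power series at the point `p` (meaningful for `p` near the origin, where the
series converges absolutely). -/
def value (f : localRing) (p : Fin 2 → ℂ) : ℂ :=
  ∑' n : Fin 2 →₀ ℕ, MvPowerSeries.coeff n f.1 * (p 0 ^ n 0 * p 1 ^ n 1)

/-- The germ `(X, 0)` defined by `f = 0` is an isolated plane curve singularity: it passes through
the origin, is singular there, and the origin is an isolated point of its singular locus
`f = ∂f/∂x = ∂f/∂y = 0`. -/
def IsIsolatedSingularity (f : localRing) : Prop :=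
  valueAtZero f = 0 ∧ (∀ i, valueAtZero (partialDeriv i f) = 0) ∧
    ∀ᶠ p in 𝓝[≠] (0 : Fin 2 → ℂ), ¬ (value f p = 0 ∧ ∀ i, value (partialDeriv i f) p = 0)

/-- The Jacobian ideal, generated by the partial derivatives. -/
def jacobianIdeal (f : localRing) : Ideal localRing :=
  Ideal.span {partialDeriv 0 f, partialDeriv 1 f}

/-- The Milnor algebra `𝒪 / J_f`. -/
abbrev MilnorAlgebra (f : localRing) : Type := localRing ⧸ jacobianIdeal f

/-- The Tjurina algebra `𝒪 / (⟨f⟩ + J_f)`. -/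
abbrev TjurinaAlgebra (f : localRing) : Type := localRing ⧸ (Ideal.span {f} ⊔ jacobianIdeal f)

/-- The Milnor number `μ`. -/
def milnorNumber (f : localRing) : ℕ := Module.finrank ℂ (MilnorAlgebra f)

/-- The Tjurina number `τ`. -/
def tjurinaNumber (f : localRing) : ℕ := Module.finrank ℂ (TjurinaAlgebra f)

/-- The quotient `ρ = μ / τ`. -/
def rho (f : localRing) : ℚ := (milnorNumber f : ℚ) / (tjurinaNumber f : ℚ)

/-- The curve germ `g = 0` is smooth at the origin. -/
def IsSmoothGerm (g : localRing) : Prop :=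
  valueAtZero g = 0 ∧ ∃ i, valueAtZero (partialDeriv i g) ≠ 0

/-- The tangent lines at the origin of the smooth germs `g = 0` and `h = 0` are distinct:
the gradients of `g` and `h` at the origin are linearly independent. -/
def HasDistinctTangents (g h : localRing) : Prop :=
  LinearIndependent ℂ
    ![fun i : Fin 2 => valueAtZero (partialDeriv i g), fun i => valueAtZero (partialDeriv i h)]

/-- The curve germ `f = 0` consists of smooth branches with pairwise distinct tangents: up to a
unit, `f` is a product of irreducible germs (the equations of the branches) which are smooth and
have pairwise distinct tangent lines. -/
def HasSmoothTransversalBranches (f : localRing) : Prop :=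
  ∃ (r : ℕ) (g : Fin r → localRing),
    Associated f (∏ j, g j) ∧ (∀ j, Irreducible (g j)) ∧ (∀ j, IsSmoothGerm (g j)) ∧
      ∀ j k, j ≠ k → HasDistinctTangents (g j) (g k)

/-- `x^{2m+1} + x^m y^{m+1} + y^{2m}`. -/
def irreducibleFamily (m : ℕ) : localRing :=
  x ^ (2 * m + 1) + x ^ m * y ^ (m + 1) + y ^ (2 * m)

/-- `x^{2m+1} + y^{2m+1} + x^{m+1} y^{m+1}`. -/
def transversalFamily (m : ℕ) : localRing :=
  x ^ (2 * m + 1) + y ^ (2 * m + 1) + x ^ (m + 1) * y ^ (m + 1)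

end

end PlaneCurve

/-!
Both families consist of germs `f = x ^ (p + 1) + y ^ (q + 1) + x ^ s * y ^ t` whose third monomial
`w` lies above the segment joining the other two. For the weights `q + 1` and `p + 1`, the partial
derivatives of `f` have initial forms `x ^ p` and `y ^ q` up to constants, so division with
remainder, Nakayama's lemma and the fact that the syzygies of the initial forms are trivial show
that the monomials `x ^ i * y ^ j` with `i < p` and `j < q` form a basis of the Milnor algebra. By
Euler's formula `f` is a nonzero multiple of `w` modulo the Jacobian ideal `J`. The colon ideal
`J : w` again contains two elements whose initial forms are powers, namely `x ^ (p - s)` and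
`y ^ (q - t)`, so passing to the Tjurina algebra removes exactly the `(p - s) * (q - t)` basis
monomials divisible by `w`.

In the first family the Newton segment has no lattice points besides its endpoints, so `f` is
irreducible. In the second one, substituting `x = y * z` and dividing by `y ^ (2 * m + 1)` leaves
`z ^ (2 * m + 1) + y * z ^ (m + 1) + 1`, whose roots at `y = 0` are simple. Hensel's lemma, proved
for convergent power series by a fixed point argument on majorants, lifts them to the branches
`x = y * t`.
-/

namespace PlaneCurve

noncomputable section

open scoped ENNReal NNReal

/-! ### Coefficients and the value at the origin -/

/-- The exponent of the monomial `x ^ i * y ^ j`. -/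
def exponent (i j : ℕ) : Fin 2 →₀ ℕ := Finsupp.single 0 i + Finsupp.single 1 j

@[simp] lemma exponent_apply_zero (i j : ℕ) : exponent i j 0 = i := by simp [exponent]

@[simp] lemma exponent_apply_one (i j : ℕ) : exponent i j 1 = j := by simp [exponent]

lemma exponent_eta (n : Fin 2 →₀ ℕ) : exponent (n 0) (n 1) = n := by
  ext i; fin_cases i <;> simp

/-- The coefficient of `x ^ i * y ^ j` in a germ, as a linear functional. -/
def coeff (i j : ℕ) : localRing →ₗ[ℂ] ℂ :=
  (MvPowerSeries.coeff (exponent i j)).comp localRing.val.toLinearMap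

lemma coeff_apply (i j : ℕ) (f : localRing) :
    coeff i j f = MvPowerSeries.coeff (exponent i j) f.1 := rfl

lemma coeff_val (n : Fin 2 →₀ ℕ) (f : localRing) :
    MvPowerSeries.coeff n f.1 = coeff (n 0) (n 1) f := by
  rw [coeff_apply, exponent_eta]

lemma localRing_ext {f g : localRing} (h : ∀ i j, coeff i j f = coeff i j g) : f = g :=
  Subtype.ext <| MvPowerSeries.ext fun n => by rw [coeff_val, coeff_val, h]

lemma coeff_zero_zero (f : localRing) : coeff 0 0 f = valueAtZero f := by
  simp [coeff_apply, valueAtZero, exponent]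

lemma xy_val (s t : ℕ) : (x ^ s * y ^ t).1 = MvPowerSeries.monomial (exponent s t) 1 := by
  change MvPowerSeries.X 0 ^ s * MvPowerSeries.X 1 ^ t = _
  rw [MvPowerSeries.X_pow_eq, MvPowerSeries.X_pow_eq, MvPowerSeries.monomial_mul_monomial,
    one_mul, exponent]

lemma coeff_mul_xy (i j s t : ℕ) (f : localRing) :
    coeff i j (f * (x ^ s * y ^ t)) =
      if s ≤ i ∧ t ≤ j then coeff (i - s) (j - t) f else 0 := by
  have hle : exponent s t ≤ exponent i j ↔ s ≤ i ∧ t ≤ j := by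
    simp [Finsupp.le_def, Fin.forall_fin_two]
  have hsub : exponent i j - exponent s t = exponent (i - s) (j - t) := by
    rw [← exponent_eta (exponent i j - exponent s t)]; simp
  change MvPowerSeries.coeff _ (f.1 * (x ^ s * y ^ t).1) = _
  rw [xy_val, MvPowerSeries.coeff_mul_monomial, mul_one, hsub, if_congr hle rfl rfl, coeff_apply]

lemma coeff_xy (i j s t : ℕ) :
    coeff i j (x ^ s * y ^ t) = if i = s ∧ j = t then 1 else 0 := by
  classical
  have heq : exponent i j = exponent s t ↔ i = s ∧ j = t := by
    simp [Finsupp.ext_iff, Fin.forall_fin_two]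
  rw [coeff_apply, xy_val, MvPowerSeries.coeff_monomial, if_congr heq rfl rfl]

/-- The value at the origin as an algebra homomorphism. -/
def valueAtZeroHom : localRing →ₐ[ℂ] ℂ where
  toFun := valueAtZero
  map_one' := by simp [valueAtZero]
  map_mul' f g := by simp [valueAtZero]
  map_zero' := by simp [valueAtZero]
  map_add' f g := by simp [valueAtZero]
  commutes' c := by simp [valueAtZero, MvPowerSeries.algebraMap_apply]

lemma valueAtZeroHom_apply (f : localRing) : valueAtZeroHom f = valueAtZero f := rfl

@[simp] lemma valueAtZero_zero : valueAtZero 0 = 0 := map_zero valueAtZeroHom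

@[simp] lemma valueAtZero_one : valueAtZero 1 = 1 := map_one valueAtZeroHom

@[simp] lemma valueAtZero_algebraMap (c : ℂ) : valueAtZero (algebraMap ℂ localRing c) = c :=
  valueAtZeroHom.commutes c

@[simp] lemma valueAtZero_add (f g : localRing) :
    valueAtZero (f + g) = valueAtZero f + valueAtZero g := map_add valueAtZeroHom f g

@[simp] lemma valueAtZero_sub (f g : localRing) :
    valueAtZero (f - g) = valueAtZero f - valueAtZero g := map_sub valueAtZeroHom f g

@[simp] lemma valueAtZero_neg (f : localRing) : valueAtZero (-f) = -valueAtZero f :=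
  map_neg valueAtZeroHom f

@[simp] lemma valueAtZero_mul (f g : localRing) :
    valueAtZero (f * g) = valueAtZero f * valueAtZero g := map_mul valueAtZeroHom f g

@[simp] lemma valueAtZero_pow (f : localRing) (n : ℕ) :
    valueAtZero (f ^ n) = valueAtZero f ^ n := map_pow valueAtZeroHom f n

@[simp] lemma valueAtZero_x : valueAtZero x = 0 := by simp [valueAtZero, x]

@[simp] lemma valueAtZero_y : valueAtZero y = 0 := by simp [valueAtZero, y]

/-! ### Majorant norms -/

/-- The sum of the absolute values of the terms of a power series on the polydisc of radius `r`. -/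
def majorant (r : ℝ≥0) (φ : MvPowerSeries (Fin 2) ℂ) : ℝ≥0∞ :=
  ∑' n : Fin 2 →₀ ℕ, ‖MvPowerSeries.coeff n φ‖ₑ * (r : ℝ≥0∞) ^ (n 0 + n 1)

lemma isConvergent_iff (φ : MvPowerSeries (Fin 2) ℂ) :
    IsConvergent φ ↔ ∃ r : ℝ≥0, 0 < r ∧ majorant r φ ≠ ∞ := by
  have hterm (r : ℝ≥0) (n : Fin 2 →₀ ℕ) :
      ‖MvPowerSeries.coeff n φ‖ₑ * (r : ℝ≥0∞) ^ (n 0 + n 1) =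
        ((‖MvPowerSeries.coeff n φ‖₊ * r ^ (n 0 + n 1) : ℝ≥0) : ℝ≥0∞) := by
    rw [enorm_eq_nnnorm]; norm_cast
  simp only [majorant, hterm, ENNReal.tsum_coe_ne_top_iff_summable_coe, IsConvergent,
    NNReal.exists, NNReal.coe_mul, NNReal.coe_pow, coe_nnnorm, NNReal.coe_mk]
  exact ⟨fun ⟨r, hr, h⟩ => ⟨r, hr.le, hr, h⟩, fun ⟨r, _, hr, h⟩ => ⟨r, hr, h⟩⟩

lemma majorant_mono {r s : ℝ≥0} (h : r ≤ s) (φ : MvPowerSeries (Fin 2) ℂ) :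
    majorant r φ ≤ majorant s φ := by
  refine ENNReal.tsum_le_tsum fun n => ?_
  gcongr

lemma majorant_add_le (r : ℝ≥0) (φ ψ : MvPowerSeries (Fin 2) ℂ) :
    majorant r (φ + ψ) ≤ majorant r φ + majorant r ψ := by
  rw [majorant, majorant, majorant, ← ENNReal.tsum_add]
  refine ENNReal.tsum_le_tsum fun n => ?_
  rw [← add_mul, map_add]
  gcongr
  exact enorm_add_le _ _

lemma majorant_mul_le (r : ℝ≥0) (φ ψ : MvPowerSeries (Fin 2) ℂ) :
    majorant r (φ * ψ) ≤ majorant r φ * majorant r ψ := by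
  classical
  let term (φ : MvPowerSeries (Fin 2) ℂ) (n : Fin 2 →₀ ℕ) : ℝ≥0∞ :=
    ‖MvPowerSeries.coeff n φ‖ₑ * (r : ℝ≥0∞) ^ (n 0 + n 1)
  have hconv (n : Fin 2 →₀ ℕ) : term (φ * ψ) n ≤
      ∑ p ∈ Finset.HasAntidiagonal.antidiagonal n, term φ p.1 * term ψ p.2 := by
    calc term (φ * ψ) n
        ≤ (∑ p ∈ Finset.HasAntidiagonal.antidiagonal n,
            ‖MvPowerSeries.coeff p.1 φ * MvPowerSeries.coeff p.2 ψ‖ₑ) *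
              (r : ℝ≥0∞) ^ (n 0 + n 1) := by
          simp only [term, MvPowerSeries.coeff_mul]
          gcongr
          exact enorm_sum_le _ _
      _ = _ := by
          rw [Finset.sum_mul]
          refine Finset.sum_congr rfl fun p hp => ?_
          obtain rfl := Finset.HasAntidiagonal.mem_antidiagonal.mp hp
          simp only [term, enorm_mul, Finsupp.add_apply]
          ring
  calc majorant r (φ * ψ)
      ≤ ∑' n, ∑ p ∈ Finset.HasAntidiagonal.antidiagonal n, term φ p.1 * term ψ p.2 :=
        ENNReal.tsum_le_tsum hconv
    _ = ∑' n, ∑' p : Finset.HasAntidiagonal.antidiagonal n, term φ p.1.1 * term ψ p.1.2 := by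
        simp_rw [tsum_fintype, Finset.univ_eq_attach,
          Finset.sum_attach _ fun p : (Fin 2 →₀ ℕ) × (Fin 2 →₀ ℕ) => term φ p.1 * term ψ p.2]
    _ = ∑' p : (Fin 2 →₀ ℕ) × (Fin 2 →₀ ℕ), term φ p.1 * term ψ p.2 := by
        rw [← ENNReal.tsum_sigma' fun q : Σ n, Finset.HasAntidiagonal.antidiagonal n =>
            term φ q.2.1.1 * term ψ q.2.1.2,
          ← Finset.HasAntidiagonal.sigmaAntidiagonalEquivProd.tsum_eq]
        rfl
    _ = majorant r φ * majorant r ψ := by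
        rw [ENNReal.tsum_prod', majorant, majorant, ← ENNReal.tsum_mul_right]
        simp_rw [← ENNReal.tsum_mul_left, term]

lemma majorant_le_div_mul {r R : ℝ≥0} (hrR : r ≤ R) (hR : R ≠ 0) {φ : MvPowerSeries (Fin 2) ℂ}
    (hφ : MvPowerSeries.constantCoeff φ = 0) :
    majorant r φ ≤ ((r / R : ℝ≥0) : ℝ≥0∞) * majorant R φ := by
  rw [majorant, majorant, ← ENNReal.tsum_mul_left]
  refine ENNReal.tsum_le_tsum fun n => ?_
  rcases hn : n 0 + n 1 with _ | k
  · obtain rfl : n = 0 := by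
      rw [← exponent_eta n, show n 0 = 0 by omega, show n 1 = 0 by omega]
      simp [exponent]
    simp [hφ]
  · rw [mul_left_comm]
    gcongr
    norm_cast
    calc r ^ (k + 1) = r / R * (r ^ k * R) := by field_simp; ring
      _ ≤ r / R * (R ^ k * R) := by gcongr
      _ = r / R * R ^ (k + 1) := by rw [pow_succ]

lemma majorant_one (r : ℝ≥0) : majorant r 1 = 1 := by
  classical
  rw [majorant, tsum_eq_single 0 fun n hn => by simp [MvPowerSeries.coeff_one, hn]]
  simp

lemma exists_eventually_majorant_le (f : localRing) :
    ∃ M : ℝ≥0, ∀ᶠ r in 𝓝[>] (0 : ℝ≥0), majorant r f.1 ≤ M := by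
  obtain ⟨R, hR, hfin⟩ := (isConvergent_iff f.1).1 f.2
  refine ⟨(majorant R f.1).toNNReal, ?_⟩
  filter_upwards [Ioc_mem_nhdsGT hR] with r hr
  rw [ENNReal.coe_toNNReal hfin]
  exact majorant_mono hr.2 _

lemma eventually_majorant_le {f : localRing} (hf : valueAtZero f = 0) {ε : ℝ≥0} (hε : 0 < ε) :
    ∀ᶠ r in 𝓝[>] (0 : ℝ≥0), majorant r f.1 ≤ ε := by
  obtain ⟨R, hR, hfin⟩ := (isConvergent_iff f.1).1 f.2
  lift majorant R f.1 to ℝ≥0 using hfin with M hM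
  have hlim : Tendsto (fun r : ℝ≥0 => r / R * M) (𝓝[>] 0) (𝓝 0) := by
    have : Continuous fun r : ℝ≥0 => r / R * M := by fun_prop
    simpa using (this.tendsto 0).mono_left nhdsWithin_le_nhds
  filter_upwards [hlim.eventually_le_const hε, Ioc_mem_nhdsGT hR] with r hε hr
  calc majorant r f.1 ≤ ((r / R : ℝ≥0) : ℝ≥0∞) * majorant R f.1 :=
        majorant_le_div_mul hr.2 hR.ne' hf
    _ ≤ ε := by rw [← hM]; exact_mod_cast hε

lemma exists_eventually_majorant_eval_le (H : Polynomial localRing) :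
    ∃ M : ℝ≥0, ∀ᶠ r in 𝓝[>] (0 : ℝ≥0),
      ∀ z : localRing, majorant r z.1 ≤ 1 → majorant r (H.eval z).1 ≤ M := by
  induction H using Polynomial.induction_on' with
  | add P Q hP hQ =>
    obtain ⟨M, hM⟩ := hP
    obtain ⟨N, hN⟩ := hQ
    refine ⟨M + N, ?_⟩
    filter_upwards [hM, hN] with r hM hN z hz
    rw [Polynomial.eval_add, ENNReal.coe_add]
    exact (majorant_add_le r _ _).trans (add_le_add (hM z hz) (hN z hz))
  | monomial n g =>
    obtain ⟨M, hM⟩ := exists_eventually_majorant_le g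
    refine ⟨M, ?_⟩
    filter_upwards [hM] with r hM z hz
    have hpow : majorant r (z ^ n).1 ≤ 1 := by
      induction n with
      | zero => exact (majorant_one r).le
      | succ n ih =>
        rw [pow_succ]
        exact (majorant_mul_le r _ _).trans (mul_le_one' ih hz)
    rw [Polynomial.eval_monomial]
    exact (majorant_mul_le r _ _).trans ((mul_le_mul' hM hpow).trans_eq (mul_one _))

/-! ### The weight filtration -/

/-- The germs all of whose monomials `x ^ i * y ^ j` have weight `a * i + b * j ≥ k`. -/
def weightIdeal (a b k : ℕ) : Ideal localRing where
  carrier := {f | (k : ℕ∞) ≤ f.1.weightedOrder ![a, b]}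
  zero_mem' := by simp
  add_mem' hf hg := (le_min hf hg).trans (MvPowerSeries.min_weightedOrder_le_add _)
  smul_mem' _ _ hf := (hf.trans le_add_self).trans (MvPowerSeries.le_weightedOrder_mul _)

lemma mem_weightIdeal_iff_le_weightedOrder {a b k : ℕ} {f : localRing} :
    f ∈ weightIdeal a b k ↔ (k : ℕ∞) ≤ f.1.weightedOrder ![a, b] := Iff.rfl

lemma weight_exponent (a b i j : ℕ) :
    Finsupp.weight ![a, b] (exponent i j) = a * i + b * j := by
  simp [exponent, Finsupp.weight_single, mul_comm]

lemma mem_weightIdeal {a b k : ℕ} {f : localRing} :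
    f ∈ weightIdeal a b k ↔ ∀ i j, a * i + b * j < k → coeff i j f = 0 := by
  constructor
  · intro hf i j hij
    refine MvPowerSeries.coeff_eq_zero_of_lt_weightedOrder ![a, b] (lt_of_lt_of_le ?_ hf)
    rw [weight_exponent]
    exact_mod_cast hij
  · refine fun h => MvPowerSeries.nat_le_weightedOrder ![a, b] fun n hn => ?_
    rw [← exponent_eta n, weight_exponent] at hn
    rw [coeff_val, h _ _ hn]

lemma weightIdeal_anti (a b : ℕ) : Antitone (weightIdeal a b) :=
  fun _ _ hjk _ hf => (Nat.cast_le.2 hjk).trans (mem_weightIdeal_iff_le_weightedOrder.1 hf)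

lemma weightIdeal_zero (a b : ℕ) : weightIdeal a b 0 = ⊤ :=
  eq_top_iff.2 fun _ _ => mem_weightIdeal.2 fun _ _ h => absurd h (Nat.not_lt_zero _)

lemma mul_mem_weightIdeal {a b j k l : ℕ} {f g : localRing} (hf : f ∈ weightIdeal a b j)
    (hg : g ∈ weightIdeal a b k) (hl : l ≤ j + k) : f * g ∈ weightIdeal a b l :=
  calc (l : ℕ∞) ≤ j + k := mod_cast hl
    _ ≤ _ := add_le_add hf hg
    _ ≤ _ := MvPowerSeries.le_weightedOrder_mul _

lemma xy_mem_weightIdeal {a b k i j : ℕ} (h : k ≤ a * i + b * j) :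
    x ^ i * y ^ j ∈ weightIdeal a b k := by
  refine mem_weightIdeal.2 fun s t hst => ?_
  rw [coeff_xy, if_neg]
  rintro ⟨rfl, rfl⟩
  omega

lemma mem_weightIdeal_one {a b : ℕ} (ha : a ≠ 0) (hb : b ≠ 0) {f : localRing} :
    f ∈ weightIdeal a b 1 ↔ valueAtZero f = 0 := by
  simp [mem_weightIdeal, ← coeff_zero_zero, ha, hb]

lemma eq_zero_of_forall_mem_weightIdeal {a b : ℕ} {f : localRing}
    (h : ∀ k, f ∈ weightIdeal a b k) : f = 0 :=
  localRing_ext fun i j => by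
    rw [map_zero]
    exact mem_weightIdeal.1 (h _) i j (Nat.lt_succ_self _)

/-! ### Hensel's lemma -/

/-- A majorant bound survives in the limit, so adic limits of bounded sequences converge. -/
lemma exists_adic_limit {Z : ℕ → localRing} {r : ℝ≥0} (hr : 0 < r) {B : ℝ≥0}
    (hB : ∀ k, majorant r (Z k).1 ≤ B) (hZ : ∀ k, Z (k + 1) - Z k ∈ weightIdeal 1 1 k) :
    ∃ z : localRing, ∀ k, z - Z k ∈ weightIdeal 1 1 k := by
  have hcauchy {k l : ℕ} (hkl : k ≤ l) : Z l - Z k ∈ weightIdeal 1 1 k := by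
    induction l, hkl using Nat.le_induction with
    | base => simp
    | succ l hkl ih =>
      rw [← sub_add_sub_cancel]
      exact add_mem (weightIdeal_anti 1 1 hkl (hZ l)) ih
  have hcoeff (i j : ℕ) {k : ℕ} (hk : i + j < k) :
      coeff i j (Z k) = coeff i j (Z (i + j + 1)) := by
    rw [← sub_eq_zero, ← map_sub]
    exact mem_weightIdeal.1 (hcauchy hk) i j (by omega)
  let ζ : MvPowerSeries (Fin 2) ℂ := fun n => coeff (n 0) (n 1) (Z (n 0 + n 1 + 1))
  have hζ (n : Fin 2 →₀ ℕ) {k : ℕ} (hk : n 0 + n 1 < k) :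
      MvPowerSeries.coeff n ζ = MvPowerSeries.coeff n (Z k).1 :=
    (hcoeff _ _ hk).symm.trans (coeff_val n _).symm
  have hζB : majorant r ζ ≤ B := by
    rw [majorant, ENNReal.tsum_eq_iSup_sum]
    refine iSup_le fun t => ?_
    let d := t.sup fun n => n 0 + n 1
    have hd : ∀ n ∈ t, n 0 + n 1 < d + 1 := fun n hn =>
      Nat.lt_succ_of_le (Finset.le_sup (f := fun n : Fin 2 →₀ ℕ => n 0 + n 1) hn)
    rw [Finset.sum_congr rfl fun n hn => by rw [hζ n (hd n hn)]]
    exact (ENNReal.sum_le_tsum t).trans (hB (d + 1))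
  refine ⟨⟨ζ, (isConvergent_iff ζ).2 ⟨r, hr, ne_top_of_le_ne_top ENNReal.coe_ne_top hζB⟩⟩,
    fun k => mem_weightIdeal.2 fun i j hij => ?_⟩
  rw [map_sub, sub_eq_zero]
  exact hζ (exponent i j) (by simpa using hij)

section FixedPoint

variable {G : Polynomial localRing}

lemma exists_ball_mapsTo_eval (h0 : valueAtZero (G.coeff 0) = 0)
    (h1 : valueAtZero (G.coeff 1) = 0) :
    ∃ r δ : ℝ≥0, 0 < r ∧ ∀ z : localRing, majorant r z.1 ≤ δ → majorant r (G.eval z).1 ≤ δ := by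
  obtain ⟨M, hM⟩ := exists_eventually_majorant_eval_le G.divX.divX
  set δ : ℝ≥0 := (4 * (M + 1))⁻¹ with hδ
  have hMδ : M * δ ≤ 4⁻¹ := by
    rw [hδ, mul_inv, mul_left_comm]
    exact mul_le_of_le_one_right' (mul_inv_le_one_of_le₀ (by simp) (by simp))
  have hδ_one : δ ≤ 1 := inv_le_one_of_one_le₀ (by nlinarith [M.2])
  have hδ_pos : 0 < δ := by positivity
  obtain ⟨r, ⟨⟨hMr, h0r⟩, h1r⟩, hr⟩ := (((hM.and (eventually_majorant_le h0 (half_pos hδ_pos))).and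
    (eventually_majorant_le h1 (ε := 4⁻¹) (by positivity))).and self_mem_nhdsWithin).exists
  refine ⟨r, δ, hr, fun z hz => ?_⟩
  have hH : majorant r (G.divX.divX.eval z).1 ≤ M := hMr z (hz.trans (mod_cast hδ_one))
  have hH1 : majorant r (G.divX.eval z).1 ≤ ((2⁻¹ : ℝ≥0) : ℝ≥0∞) := by
    rw [← Polynomial.divX_mul_X_add G.divX, Polynomial.eval_add, Polynomial.eval_mul_X,
      Polynomial.eval_C, Polynomial.coeff_divX]
    calc majorant r (G.divX.divX.eval z * z + G.coeff 1).1
        ≤ majorant r (G.divX.divX.eval z).1 * majorant r z.1 + majorant r (G.coeff 1).1 :=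
          (majorant_add_le r _ _).trans (by gcongr; exact majorant_mul_le r _ _)
      _ ≤ M * δ + (4⁻¹ : ℝ≥0) := by gcongr
      _ ≤ _ := by
          norm_cast
          exact (add_le_add_left hMδ _).trans_eq (by norm_num [← NNReal.coe_inj])
  rw [← Polynomial.divX_mul_X_add G, Polynomial.eval_add, Polynomial.eval_mul_X, Polynomial.eval_C]
  calc majorant r (G.divX.eval z * z + G.coeff 0).1
      ≤ majorant r (G.divX.eval z).1 * majorant r z.1 + majorant r (G.coeff 0).1 :=
        (majorant_add_le r _ _).trans (by gcongr; exact majorant_mul_le r _ _)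
    _ ≤ (2⁻¹ : ℝ≥0) * δ + (δ / 2 : ℝ≥0) := by gcongr
    _ = δ := by
        norm_cast
        rw [inv_mul_eq_div, add_halves]

lemma eval_sub_eval_mem_weightIdeal (h1 : valueAtZero (G.coeff 1) = 0) {z z' : localRing}
    (hz : valueAtZero z = 0) (hz' : valueAtZero z' = 0) {k : ℕ} (h : z - z' ∈ weightIdeal 1 1 k) :
    G.eval z - G.eval z' ∈ weightIdeal 1 1 (k + 1) := by
  obtain ⟨c, hc⟩ := Polynomial.sub_dvd_eval_sub z z' G.divX
  have heval (w : localRing) : G.eval w = G.divX.eval w * w + G.coeff 0 := by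
    conv_lhs => rw [← Polynomial.divX_mul_X_add G]
    rw [Polynomial.eval_add, Polynomial.eval_mul_X, Polynomial.eval_C]
  have hfactor : G.eval z - G.eval z' = (z - z') * (G.divX.eval z + c * z') := by
    rw [heval, heval]
    linear_combination z' * hc
  have hslope : valueAtZero (G.divX.eval z) = 0 := by
    rw [← Polynomial.divX_mul_X_add G.divX, Polynomial.eval_add, Polynomial.eval_mul_X,
      Polynomial.eval_C, Polynomial.coeff_divX]
    simp [hz, h1]
  rw [hfactor]
  exact mul_mem_weightIdeal h
    ((mem_weightIdeal_one one_ne_zero one_ne_zero).2 (by simp [hslope, hz'])) le_rfl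

theorem exists_eval_eq_self (h0 : valueAtZero (G.coeff 0) = 0)
    (h1 : valueAtZero (G.coeff 1) = 0) : ∃ z, valueAtZero z = 0 ∧ G.eval z = z := by
  obtain ⟨r, δ, hr, hball⟩ := exists_ball_mapsTo_eval h0 h1
  let Z (k : ℕ) : localRing := (fun z => G.eval z)^[k] 0
  have hZ (k : ℕ) : Z (k + 1) = G.eval (Z k) := Function.iterate_succ_apply' _ _ _
  have hbound (k : ℕ) : majorant r (Z k).1 ≤ δ := by
    induction k with
    | zero => simp [Z, majorant]
    | succ k ih => rw [hZ]; exact hball _ ih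
  have hzero (k : ℕ) : valueAtZero (Z k) = 0 := by
    induction k with
    | zero => exact valueAtZero_zero
    | succ k ih =>
      rw [hZ, ← Polynomial.divX_mul_X_add G, Polynomial.eval_add, Polynomial.eval_mul_X,
        Polynomial.eval_C]
      simp [ih, h0]
  have hstep (k : ℕ) : Z (k + 1) - Z k ∈ weightIdeal 1 1 k := by
    induction k with
    | zero => simp [weightIdeal_zero]
    | succ k ih =>
      rw [hZ (k + 1)]
      nth_rewrite 2 [hZ k]
      exact eval_sub_eval_mem_weightIdeal h1 (hzero _) (hzero _) ih
  obtain ⟨z, hz⟩ := exists_adic_limit hr hbound hstep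
  have hz0 : valueAtZero z = 0 := by
    simpa [hzero] using (mem_weightIdeal_one one_ne_zero one_ne_zero).1 (hz 1)
  refine ⟨z, hz0, sub_eq_zero.1 (eq_zero_of_forall_mem_weightIdeal (a := 1) (b := 1) fun k => ?_)⟩
  rw [← sub_sub_sub_cancel_right _ _ (Z (k + 1))]
  refine sub_mem ?_ (weightIdeal_anti 1 1 k.le_succ (hz (k + 1)))
  rw [hZ]
  exact weightIdeal_anti 1 1 k.le_succ (eval_sub_eval_mem_weightIdeal h1 hz0 (hzero k) (hz k))

end FixedPoint

theorem exists_root_of_simple_root (P : Polynomial localRing) (a : localRing)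
    (h0 : valueAtZero (P.eval a) = 0) (h1 : valueAtZero (P.derivative.eval a) ≠ 0) :
    ∃ t, valueAtZero t = valueAtZero a ∧ P.eval t = 0 := by
  set c := algebraMap ℂ localRing (valueAtZero (P.derivative.eval a))⁻¹ with hc
  -- One step of Newton's method, with the derivative replaced by its value at the origin.
  obtain ⟨z, hz0, hz⟩ :=
    exists_eval_eq_self (G := Polynomial.X - Polynomial.C c * Polynomial.taylor a P)
      (by simp [Polynomial.taylor_coeff_zero, h0])
      (by simp [Polynomial.taylor_coeff_one, hc, h1])
  refine ⟨z + a, by simp [hz0], ?_⟩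
  have hc_ne : c ≠ 0 := by simpa [hc] using h1
  have : c * P.eval (z + a) = 0 := by
    simpa [Polynomial.taylor_eval] using hz
  exact (mul_eq_zero.1 this).resolve_left hc_ne

lemma isUnit_iff_valueAtZero_ne_zero {f : localRing} : IsUnit f ↔ valueAtZero f ≠ 0 := by
  refine ⟨fun h => (h.map valueAtZeroHom).ne_zero, fun h => ?_⟩
  obtain ⟨g, -, hg⟩ := exists_root_of_simple_root
    (Polynomial.C f * Polynomial.X - 1) (algebraMap ℂ localRing (valueAtZero f)⁻¹)
    (by simp [h]) (by simp [h])
  exact IsUnit.of_mul_eq_one g (by simpa [sub_eq_zero] using hg)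

instance : IsLocalHom valueAtZeroHom.toRingHom where
  map_nonunit _ h := isUnit_iff_valueAtZero_ne_zero.2 h.ne_zero

instance : IsLocalRing localRing := RingHom.domain_isLocalRing valueAtZeroHom.toRingHom

lemma mem_maximalIdeal {f : localRing} :
    f ∈ IsLocalRing.maximalIdeal localRing ↔ valueAtZero f = 0 := by
  rw [IsLocalRing.mem_maximalIdeal, mem_nonunits_iff, isUnit_iff_valueAtZero_ne_zero, not_not]

/-! ### Finite generation of the weight ideals -/

/-- The germ obtained from `f` by dropping the terms not divisible by `x ^ s * y ^ t` and dividing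
the others by this monomial. -/
def divMonomial (s t : ℕ) (f : localRing) : localRing :=
  ⟨fun n => MvPowerSeries.coeff (n + exponent s t) f.1, by
    obtain ⟨r, hr, hf⟩ := f.2
    refine ⟨r, hr, ((hf.comp_injective (add_left_injective (exponent s t))).mul_left
      (r ^ (s + t))⁻¹).congr fun n => ?_⟩
    change _ = ‖MvPowerSeries.coeff (n + exponent s t) f.1‖ * r ^ (n 0 + n 1)
    simp only [Function.comp_apply, Finsupp.add_apply, exponent_apply_zero, exponent_apply_one]
    field_simp
    ring⟩

lemma coeff_divMonomial (s t i j : ℕ) (f : localRing) :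
    coeff i j (divMonomial s t f) = coeff (i + s) (j + t) f := by
  change MvPowerSeries.coeff (exponent i j + exponent s t) f.1 = _
  simp [coeff_val]

lemma divMonomial_mul_xy {s t : ℕ} {f : localRing}
    (hf : ∀ i j, i < s ∨ j < t → coeff i j f = 0) : divMonomial s t f * (x ^ s * y ^ t) = f := by
  refine localRing_ext fun i j => ?_
  rw [coeff_mul_xy, coeff_divMonomial]
  split_ifs with h
  · rw [Nat.sub_add_cancel h.1, Nat.sub_add_cancel h.2]
  · rw [hf i j (by omega)]

variable {a b : ℕ}

lemma divMonomial_mem_weightIdeal {k : ℕ} {f : localRing} (hf : f ∈ weightIdeal a b k) (s t : ℕ) :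
    divMonomial s t f ∈ weightIdeal a b (k - (a * s + b * t)) :=
  mem_weightIdeal.2 fun i j hij => by
    rw [coeff_divMonomial]
    exact mem_weightIdeal.1 hf _ _ (by rw [mul_add, mul_add]; omega)

lemma x_mem_weightIdeal : x ∈ weightIdeal a b a := by
  simpa using xy_mem_weightIdeal (a := a) (b := b) (i := 1) (j := 0) le_rfl

lemma y_mem_weightIdeal : y ∈ weightIdeal a b b := by
  simpa using xy_mem_weightIdeal (a := a) (b := b) (i := 0) (j := 1) le_rfl

lemma weightIdeal_eq_mul_sup_mul {k : ℕ} (hk : 0 < k) :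
    weightIdeal a b k =
      weightIdeal a b (k - a) * Ideal.span {x} ⊔ weightIdeal a b (k - b) * Ideal.span {y} := by
  refine le_antisymm (fun f hf => ?_) (sup_le ?_ ?_)
  · have hα := divMonomial_mem_weightIdeal hf 1 0
    have hg : f - divMonomial 1 0 f * x ∈ weightIdeal a b k :=
      sub_mem hf (mul_mem_weightIdeal hα x_mem_weightIdeal (by omega))
    have hβ := divMonomial_mem_weightIdeal hg 0 1
    have hdiv : divMonomial 0 1 (f - divMonomial 1 0 f * x) * y = f - divMonomial 1 0 f * x := by
      have hx : divMonomial 1 0 f * x = divMonomial 1 0 f * (x ^ 1 * y ^ 0) := by ring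
      convert divMonomial_mul_xy (s := 0) (t := 1) fun i j hij => ?_ using 2
      · ring
      · obtain rfl : j = 0 := by omega
        rw [hx, map_sub, coeff_mul_xy, coeff_divMonomial]
        rcases i with _ | i
        · simp [mem_weightIdeal.1 hf 0 0 (by omega)]
        · simp
    rw [← sub_add_cancel f (divMonomial 1 0 f * x), ← hdiv, add_comm]
    simp only [mul_zero, mul_one, zero_add, add_zero] at hα hβ
    exact Submodule.add_mem_sup (Ideal.mul_mem_mul hα (Ideal.mem_span_singleton_self x))
      (Ideal.mul_mem_mul hβ (Ideal.mem_span_singleton_self y))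
  · refine Ideal.mul_le.2 fun g hg z hz => ?_
    obtain ⟨c, rfl⟩ := Ideal.mem_span_singleton'.1 hz
    exact mul_mem_weightIdeal hg (Ideal.mul_mem_left _ c x_mem_weightIdeal) (by omega)
  · refine Ideal.mul_le.2 fun g hg z hz => ?_
    obtain ⟨c, rfl⟩ := Ideal.mem_span_singleton'.1 hz
    exact mul_mem_weightIdeal hg (Ideal.mul_mem_left _ c y_mem_weightIdeal) (by omega)

lemma weightIdeal_fg (ha : 0 < a) (hb : 0 < b) (k : ℕ) : (weightIdeal a b k).FG := by
  induction k using Nat.strong_induction_on with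
  | _ k ih =>
    rcases Nat.eq_zero_or_pos k with rfl | hk
    · rw [weightIdeal_zero]
      exact ⟨{1}, by simp⟩
    · rw [weightIdeal_eq_mul_sup_mul hk]
      exact Submodule.FG.sup ((ih _ (by omega)).mul (Submodule.fg_span_singleton x))
        ((ih _ (by omega)).mul (Submodule.fg_span_singleton y))

lemma weightIdeal_add_le_maximalIdeal_mul (ha : 0 < a) (k : ℕ) :
    weightIdeal a b (k + a + b) ≤ IsLocalRing.maximalIdeal localRing * weightIdeal a b k := by
  rw [weightIdeal_eq_mul_sup_mul (by omega), mul_comm, mul_comm (weightIdeal a b _)]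
  refine sup_le (Ideal.mul_mono ?_ (weightIdeal_anti a b (by omega)))
    (Ideal.mul_mono ?_ (weightIdeal_anti a b (by omega)))
  · exact (Ideal.span_singleton_le_iff_mem _).2 (mem_maximalIdeal.2 valueAtZero_x)
  · exact (Ideal.span_singleton_le_iff_mem _).2 (mem_maximalIdeal.2 valueAtZero_y)

/-! ### Division by a semi-quasihomogeneous pair -/

/-- The linear span of the monomials `x ^ i * y ^ j` with `(i, j) ∈ S`. -/
def monomialSpan (S : Set (ℕ × ℕ)) : Submodule ℂ localRing :=
  Submodule.span ℂ ((fun s : ℕ × ℕ => x ^ s.1 * y ^ s.2) '' S)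

lemma xy_mem_monomialSpan {S : Set (ℕ × ℕ)} {i j : ℕ} (h : (i, j) ∈ S) :
    x ^ i * y ^ j ∈ monomialSpan S := Submodule.subset_span ⟨(i, j), h, rfl⟩

lemma monomialSpan_le {S : Set (ℕ × ℕ)} {T : Submodule ℂ localRing} :
    monomialSpan S ≤ T ↔ ∀ i j, (i, j) ∈ S → x ^ i * y ^ j ∈ T := by
  rw [monomialSpan, Submodule.span_le, Set.image_subset_iff]
  exact ⟨fun h i j hij => h hij, fun h s hs => h s.1 s.2 hs⟩

lemma coeff_eq_zero_of_mem_monomialSpan {S : Set (ℕ × ℕ)} {i j : ℕ} {f : localRing}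
    (hf : f ∈ monomialSpan S) (hij : (i, j) ∉ S) : coeff i j f = 0 := by
  have hle : monomialSpan S ≤ LinearMap.ker (coeff i j) := monomialSpan_le.2 fun s t hst => by
    rw [LinearMap.mem_ker, coeff_xy, if_neg]
    rintro ⟨rfl, rfl⟩
    exact hij hst
  exact hle hf

lemma weightIdeal_le_monomialSpan_sup (ha : 0 < a) (hb : 0 < b) (k : ℕ) :
    (weightIdeal a b k).restrictScalars ℂ ≤
      monomialSpan {s | a * s.1 + b * s.2 = k} ⊔ (weightIdeal a b (k + 1)).restrictScalars ℂ := by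
  intro f hf
  let S := {s ∈ Finset.range (k + 1) ×ˢ Finset.range (k + 1) | a * s.1 + b * s.2 = k}
  let g : localRing := ∑ s ∈ S, coeff s.1 s.2 f • (x ^ s.1 * y ^ s.2)
  have hg : g ∈ monomialSpan {s | a * s.1 + b * s.2 = k} :=
    Submodule.sum_mem _ fun s hs => Submodule.smul_mem _ _
      (xy_mem_monomialSpan (Finset.mem_filter.1 hs).2)
  have hcoeff {i j : ℕ} (hij : a * i + b * j = k) : coeff i j g = coeff i j f := by
    have hmem : (i, j) ∈ S := by
      simp only [S, Finset.mem_filter, Finset.mem_product, Finset.mem_range]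
      exact ⟨⟨by nlinarith, by nlinarith⟩, hij⟩
    simp only [g, map_sum, map_smul, coeff_xy, smul_eq_mul, mul_ite, mul_one, mul_zero]
    rw [Finset.sum_eq_single_of_mem _ hmem fun s _ hs => if_neg fun h =>
      hs (Prod.ext h.1.symm h.2.symm)]
    simp
  have hfg : f - g ∈ weightIdeal a b (k + 1) := mem_weightIdeal.2 fun i j hij => by
    rw [map_sub, sub_eq_zero]
    rcases (Nat.lt_succ_iff.1 hij).eq_or_lt with h | h
    · exact (hcoeff h).symm
    · rw [mem_weightIdeal.1 hf i j h, coeff_eq_zero_of_mem_monomialSpan hg h.ne]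
  rw [← add_sub_cancel g f]
  exact Submodule.add_mem_sup hg hfg

lemma coeff_mul_eq_of_sub_mem {c g g₀ : localRing} {d k i j : ℕ} (hc : c ∈ weightIdeal a b (k - d))
    (hg : g - g₀ ∈ weightIdeal a b (d + 1)) (hij : a * i + b * j ≤ k) :
    coeff i j (c * g) = coeff i j (c * g₀) := by
  rw [← sub_eq_zero, ← map_sub, ← mul_sub]
  exact mem_weightIdeal.1 (mul_mem_weightIdeal hc hg (l := k + 1) (by omega)) i j (by omega)

/-- For the weights `a` and `b` of `x` and `y`, the initial forms of `u` and `v` are the powers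
`x ^ p` and `y ^ q`. -/
structure HasInitialPowers (a b p q : ℕ) (u v : localRing) : Prop where
  left : u - x ^ p ∈ weightIdeal a b (a * p + 1)
  right : v - y ^ q ∈ weightIdeal a b (b * q + 1)

namespace HasInitialPowers

variable {p q : ℕ} {u v : localRing}

lemma xy_mem_span_pair_sup (h : HasInitialPowers a b p q u v) {i j : ℕ} (hij : p ≤ i ∨ q ≤ j) :
    x ^ i * y ^ j ∈ Ideal.span {u, v} ⊔ weightIdeal a b (a * i + b * j + 1) := by
  rcases hij with hi | hj
  · obtain ⟨l, rfl⟩ := Nat.exists_eq_add_of_le hi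
    have hsplit : x ^ (p + l) * y ^ j = x ^ l * y ^ j * u - x ^ l * y ^ j * (u - x ^ p) := by ring
    rw [hsplit]
    exact sub_mem
      (Ideal.mem_sup_left (Ideal.mul_mem_left _ _ (Ideal.subset_span (by simp))))
      (Ideal.mem_sup_right (mul_mem_weightIdeal (xy_mem_weightIdeal le_rfl) h.left
        (by rw [mul_add]; omega)))
  · obtain ⟨l, rfl⟩ := Nat.exists_eq_add_of_le hj
    have hsplit : x ^ i * y ^ (q + l) = x ^ i * y ^ l * v - x ^ i * y ^ l * (v - y ^ q) := by ring
    rw [hsplit]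
    exact sub_mem
      (Ideal.mem_sup_left (Ideal.mul_mem_left _ _ (Ideal.subset_span (by simp))))
      (Ideal.mem_sup_right (mul_mem_weightIdeal (xy_mem_weightIdeal le_rfl) h.right
        (by rw [mul_add]; omega)))

lemma weightIdeal_le_span_pair (h : HasInitialPowers a b p q u v) (ha : 0 < a) (hb : 0 < b) :
    weightIdeal a b (a * p + b * q) ≤ Ideal.span {u, v} := by
  have step {k : ℕ} (hk : a * p + b * q ≤ k) :
      weightIdeal a b k ≤ Ideal.span {u, v} ⊔ weightIdeal a b (k + 1) := by
    have hmono : monomialSpan {s | a * s.1 + b * s.2 = k} ≤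
        (Ideal.span {u, v} ⊔ weightIdeal a b (k + 1)).restrictScalars ℂ := by
      refine monomialSpan_le.2 fun i j hij => ?_
      obtain rfl : a * i + b * j = k := hij
      refine h.xy_mem_span_pair_sup ?_
      by_contra! hlt
      nlinarith [Nat.mul_lt_mul_of_pos_left hlt.1 ha, Nat.mul_lt_mul_of_pos_left hlt.2 hb]
    exact (weightIdeal_le_monomialSpan_sup ha hb k).trans
      (sup_le hmono ((Submodule.restrictScalars_le ℂ).2 le_sup_right))
  have steps (l : ℕ) : weightIdeal a b (a * p + b * q) ≤
      Ideal.span {u, v} ⊔ weightIdeal a b (a * p + b * q + l) := by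
    induction l with
    | zero => exact le_sup_right
    | succ l ih => exact ih.trans (sup_le le_sup_left (step (Nat.le_add_right _ l)))
  refine Submodule.le_of_le_smul_of_le_jacobson_bot (weightIdeal_fg ha hb _)
    (IsLocalRing.maximalIdeal_le_jacobson ⊥) ((steps (a + b)).trans (sup_le_sup_left ?_ _))
  rw [← add_assoc]
  exact weightIdeal_add_le_maximalIdeal_mul ha _

lemma codisjoint_monomialSpan_span_pair (h : HasInitialPowers a b p q u v) (ha : 0 < a)
    (hb : 0 < b) :
    Codisjoint (monomialSpan (Finset.range p ×ˢ Finset.range q : Finset (ℕ × ℕ)))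
      ((Ideal.span {u, v}).restrictScalars ℂ) := by
  set T := monomialSpan (Finset.range p ×ˢ Finset.range q : Finset (ℕ × ℕ)) ⊔
    (Ideal.span {u, v}).restrictScalars ℂ
  have hweight {k : ℕ} (hk : k ≤ a * p + b * q) : (weightIdeal a b k).restrictScalars ℂ ≤ T := by
    induction hk using Nat.decreasingInduction with
    | self => exact le_sup_of_le_right (h.weightIdeal_le_span_pair ha hb)
    | of_succ k hk ih =>
      refine (weightIdeal_le_monomialSpan_sup ha hb k).trans (sup_le ?_ ih)
      refine monomialSpan_le.2 fun i j hij => ?_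
      obtain rfl : a * i + b * j = k := hij
      by_cases hrect : i < p ∧ j < q
      · exact Submodule.mem_sup_left (xy_mem_monomialSpan (by simpa using hrect))
      · obtain ⟨g, hg, w, hw, hgw⟩ := Submodule.mem_sup.1
          (h.xy_mem_span_pair_sup (i := i) (j := j) (by omega))
        rw [← hgw]
        exact add_mem (Submodule.mem_sup_right hg) (ih hw)
  refine codisjoint_iff.2 (top_le_iff.1 fun f _ => hweight (Nat.zero_le _) ?_)
  simp [weightIdeal_zero]

/-- If all monomials of `Q * u + R * v` lie in the rectangle, then the initial forms of `Q` and `R`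
are a multiple of the trivial syzygy `(y ^ q, -x ^ p)`. -/
lemma syzygy_step (h : HasInitialPowers a b p q u v) {k : ℕ} {Q R : localRing}
    (hQ : Q ∈ weightIdeal a b (k - a * p)) (hR : R ∈ weightIdeal a b (k - b * q))
    (hf : ∀ i j, p ≤ i ∨ q ≤ j → coeff i j (Q * u + R * v) = 0) :
    Q - divMonomial 0 q Q * v ∈ weightIdeal a b (k + 1 - a * p) ∧
      R + divMonomial 0 q Q * u ∈ weightIdeal a b (k + 1 - b * q) := by
  have hc := divMonomial_mem_weightIdeal hQ 0 q
  rw [mul_zero, zero_add] at hc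
  have hinit (i j : ℕ) (hij : p ≤ i ∨ q ≤ j) (hk : a * i + b * j ≤ k) :
      coeff i j (Q * x ^ p) + coeff i j (R * y ^ q) = 0 := by
    rw [← coeff_mul_eq_of_sub_mem hQ h.left hk, ← coeff_mul_eq_of_sub_mem hR h.right hk,
      ← map_add, hf i j hij]
  have hx (f : localRing) (i j : ℕ) :
      coeff i j (f * x ^ p) = if p ≤ i then coeff (i - p) j f else 0 := by
    simpa using coeff_mul_xy i j p 0 f
  have hy (f : localRing) (i j : ℕ) :
      coeff i j (f * y ^ q) = if q ≤ j then coeff i (j - q) f else 0 := by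
    simpa using coeff_mul_xy i j 0 q f
  constructor
  · refine mem_weightIdeal.2 fun i j hij => ?_
    rw [map_sub, coeff_mul_eq_of_sub_mem hc h.right (by omega), hy, coeff_divMonomial]
    split_ifs with hq
    · rw [add_zero, Nat.sub_add_cancel hq, sub_self]
    · simpa [hx, hy, hq] using hinit (i + p) j (by omega) (by rw [mul_add]; omega)
  · refine mem_weightIdeal.2 fun i j hij => ?_
    rw [map_add, coeff_mul_eq_of_sub_mem (Nat.sub_right_comm k _ _ ▸ hc) h.left (by omega), hx,
      coeff_divMonomial, add_zero]
    simpa [hx, hy, add_comm] using hinit i (j + q) (by omega) (by rw [mul_add]; omega)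

lemma disjoint_monomialSpan_span_pair (h : HasInitialPowers a b p q u v) :
    Disjoint (monomialSpan (Finset.range p ×ˢ Finset.range q : Finset (ℕ × ℕ)))
      ((Ideal.span {u, v}).restrictScalars ℂ) := by
  refine Submodule.disjoint_def.2 fun f hf hfuv => ?_
  have hcoeff (i j : ℕ) (hij : p ≤ i ∨ q ≤ j) : coeff i j f = 0 :=
    coeff_eq_zero_of_mem_monomialSpan hf <| by
      simp only [Finset.coe_product, Finset.coe_range, Set.mem_prod, Set.mem_Iio]
      omega
  have hrep (k : ℕ) : ∃ Q ∈ weightIdeal a b (k - a * p), ∃ R ∈ weightIdeal a b (k - b * q),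
      Q * u + R * v = f := by
    induction k with
    | zero =>
      obtain ⟨Q, R, hQR⟩ := Ideal.mem_span_pair.1 hfuv
      exact ⟨Q, by simp [weightIdeal_zero], R, by simp [weightIdeal_zero], hQR⟩
    | succ k ih =>
      obtain ⟨Q, hQ, R, hR, rfl⟩ := ih
      obtain ⟨hQ', hR'⟩ := h.syzygy_step hQ hR hcoeff
      exact ⟨_, hQ', _, hR', by ring⟩
  have hu : u ∈ weightIdeal a b (a * p) :=
    (Submodule.sub_mem_iff_left _ (by simpa using xy_mem_weightIdeal (j := 0) le_rfl)).1
      (weightIdeal_anti a b (Nat.le_succ _) h.left)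
  have hv : v ∈ weightIdeal a b (b * q) :=
    (Submodule.sub_mem_iff_left _ (by simpa using xy_mem_weightIdeal (i := 0) le_rfl)).1
      (weightIdeal_anti a b (Nat.le_succ _) h.right)
  refine eq_zero_of_forall_mem_weightIdeal (a := a) (b := b) fun k => ?_
  obtain ⟨Q, hQ, R, hR, rfl⟩ := hrep k
  exact add_mem (mul_mem_weightIdeal hQ hu (by omega)) (mul_mem_weightIdeal hR hv (by omega))

theorem isCompl_monomialSpan_span_pair (h : HasInitialPowers a b p q u v) (ha : 0 < a)
    (hb : 0 < b) :
    IsCompl (monomialSpan (Finset.range p ×ˢ Finset.range q : Finset (ℕ × ℕ)))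
      ((Ideal.span {u, v}).restrictScalars ℂ) :=
  ⟨h.disjoint_monomialSpan_span_pair, h.codisjoint_monomialSpan_span_pair ha hb⟩

end HasInitialPowers

/-! ### Monomial bases of quotients -/

lemma linearIndependent_xy : LinearIndependent ℂ fun s : ℕ × ℕ => x ^ s.1 * y ^ s.2 :=
  .of_pairwise_dual_eq_zero_one _ (fun s => coeff s.1 s.2)
    (fun _ _ hst => (coeff_xy _ _ _ _).trans (if_neg fun h => hst (Prod.ext h.1 h.2)))
    (fun s => by simp [coeff_xy])

lemma monomialSpan_union (S T : Set (ℕ × ℕ)) :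
    monomialSpan (S ∪ T) = monomialSpan S ⊔ monomialSpan T := by
  rw [monomialSpan, Set.image_union, Submodule.span_union, monomialSpan, monomialSpan]

lemma disjoint_monomialSpan {S T : Set (ℕ × ℕ)} (h : Disjoint S T) :
    Disjoint (monomialSpan S) (monomialSpan T) :=
  linearIndependent_xy.disjoint_span_image h

lemma finrank_monomialSpan (S : Finset (ℕ × ℕ)) :
    Module.finrank ℂ (monomialSpan (S : Set (ℕ × ℕ))) = S.card := by
  rw [monomialSpan, Set.image_eq_range]
  exact (finrank_span_eq_card
    (linearIndependent_xy.comp (Subtype.val : S → ℕ × ℕ) Subtype.val_injective)).trans (by simp)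

section Quotient

variable {S : Finset (ℕ × ℕ)} {I : Ideal localRing}

/-- A monomial complement of an ideal is isomorphic to the quotient ring. -/
def quotientEquivMonomialSpan (h : IsCompl (monomialSpan S) (I.restrictScalars ℂ)) :
    (localRing ⧸ I) ≃ₗ[ℂ] monomialSpan (S : Set (ℕ × ℕ)) :=
  (Submodule.Quotient.restrictScalarsEquiv ℂ I).symm ≪≫ₗ
    Submodule.quotientEquivOfIsCompl _ _ h.symm

lemma finiteDimensional_quotient_of_isCompl
    (h : IsCompl (monomialSpan S) (I.restrictScalars ℂ)) : FiniteDimensional ℂ (localRing ⧸ I) := by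
  have : FiniteDimensional ℂ (monomialSpan (S : Set (ℕ × ℕ))) :=
    FiniteDimensional.span_of_finite ℂ (S.finite_toSet.image _)
  exact Module.Finite.equiv (quotientEquivMonomialSpan h).symm

lemma finrank_quotient_of_isCompl
    (h : IsCompl (monomialSpan S) (I.restrictScalars ℂ)) :
    Module.finrank ℂ (localRing ⧸ I) = S.card :=
  (quotientEquivMonomialSpan h).finrank_eq.trans (finrank_monomialSpan S)

end Quotient

namespace HasInitialPowers

variable {a b p q s t : ℕ} {u v u' v' : localRing}

/-- The right-hand side arises by multiplying a monomial basis of the quotient by `(u', v')` with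
`x ^ s * y ^ t`. -/
lemma span_xy_sup_span_pair_eq (h' : HasInitialPowers a b (p - s) (q - t) u' v')
    (ha : 0 < a) (hb : 0 < b)
    (hu : x ^ s * y ^ t * u' ∈ Ideal.span {u, v}) (hv : x ^ s * y ^ t * v' ∈ Ideal.span {u, v}) :
    (Ideal.span {x ^ s * y ^ t} ⊔ Ideal.span {u, v}).restrictScalars ℂ =
      monomialSpan (Finset.Ico s p ×ˢ Finset.Ico t q : Finset (ℕ × ℕ)) ⊔
        (Ideal.span {u, v}).restrictScalars ℂ := by
  refine le_antisymm (fun f hf => ?_) (sup_le (monomialSpan_le.2 fun i j hij => ?_)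
    ((Submodule.restrictScalars_le ℂ).2 le_sup_right))
  · obtain ⟨_, hg, f', hf', rfl⟩ := Submodule.mem_sup.1 ((Submodule.restrictScalars_mem ℂ _ _).1 hf)
    refine add_mem ?_ (Submodule.mem_sup_right hf')
    obtain ⟨c, rfl⟩ := Ideal.mem_span_singleton'.1 hg
    obtain ⟨m, hm, d, hd, rfl⟩ := Submodule.mem_sup.1
      ((h'.codisjoint_monomialSpan_span_pair ha hb).eq_top.ge (Submodule.mem_top (x := c)))
    rw [add_mul]
    refine add_mem (Submodule.mem_sup_left ?_) (Submodule.mem_sup_right ?_)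
    · have hle : monomialSpan (Finset.range (p - s) ×ˢ Finset.range (q - t) : Finset (ℕ × ℕ)) ≤
          (monomialSpan (Finset.Ico s p ×ˢ Finset.Ico t q : Finset (ℕ × ℕ))).comap
            (LinearMap.mulRight ℂ (x ^ s * y ^ t)) := monomialSpan_le.2 fun i j hij => by
        have hshift : x ^ i * y ^ j * (x ^ s * y ^ t) = x ^ (i + s) * y ^ (j + t) := by ring
        rw [Submodule.mem_comap, LinearMap.mulRight_apply, hshift]
        refine xy_mem_monomialSpan ?_
        simp only [Finset.coe_product, Finset.coe_range, Finset.coe_Ico, Set.mem_prod, Set.mem_Iio,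
          Set.mem_Ico] at hij ⊢
        omega
      exact hle hm
    · obtain ⟨c, e, rfl⟩ := Ideal.mem_span_pair.1 ((Submodule.restrictScalars_mem ℂ _ _).1 hd)
      have hsplit : (c * u' + e * v') * (x ^ s * y ^ t) =
          c * (x ^ s * y ^ t * u') + e * (x ^ s * y ^ t * v') := by ring
      rw [hsplit]
      exact add_mem (Ideal.mul_mem_left _ c hu) (Ideal.mul_mem_left _ e hv)
  · simp only [Finset.coe_product, Finset.coe_Ico, Set.mem_prod, Set.mem_Ico] at hij
    refine Ideal.mem_sup_left (Ideal.mem_span_singleton.2 ?_)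
    exact mul_dvd_mul (pow_dvd_pow x hij.1.1) (pow_dvd_pow y hij.2.1)

theorem isCompl_monomialSpan_sdiff (h : HasInitialPowers a b p q u v)
    (h' : HasInitialPowers a b (p - s) (q - t) u' v') (ha : 0 < a) (hb : 0 < b)
    (hu : x ^ s * y ^ t * u' ∈ Ideal.span {u, v}) (hv : x ^ s * y ^ t * v' ∈ Ideal.span {u, v}) :
    IsCompl
      (monomialSpan ((Finset.range p ×ˢ Finset.range q) \ (Finset.Ico s p ×ˢ Finset.Ico t q) :
        Finset (ℕ × ℕ)))
      ((Ideal.span {x ^ s * y ^ t} ⊔ Ideal.span {u, v}).restrictScalars ℂ) := by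
  have hsub : Finset.Ico s p ×ˢ Finset.Ico t q ⊆ Finset.range p ×ˢ Finset.range q :=
    Finset.product_subset_product
      (fun i hi => Finset.mem_range.2 (Finset.mem_Ico.1 hi).2)
      (fun j hj => Finset.mem_range.2 (Finset.mem_Ico.1 hj).2)
  have hcompl := h.isCompl_monomialSpan_span_pair ha hb
  rw [← Finset.sdiff_union_of_subset hsub, Finset.coe_union, monomialSpan_union] at hcompl
  rw [h'.span_xy_sup_span_pair_eq ha hb hu hv]
  exact ⟨Disjoint.disjoint_sup_right_of_disjoint_sup_left
      (disjoint_monomialSpan (Finset.disjoint_coe.2 Finset.sdiff_disjoint)) hcompl.disjoint,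
    codisjoint_iff.2 (by rw [← sup_assoc]; exact hcompl.sup_eq_top)⟩

end HasInitialPowers

/-! ### Partial derivatives -/

/-- The partial derivatives as derivations of `ℂ{x, y}`. -/
def partialDerivation (i : Fin 2) : Derivation ℂ localRing localRing :=
  Derivation.mk'
    { toFun := partialDeriv i
      map_add' := fun f g => Subtype.ext (map_add (MvPowerSeries.pderiv ℂ i) f.1 g.1)
      map_smul' := fun c f => Subtype.ext ((MvPowerSeries.pderiv ℂ i).map_smul c f.1) }
    fun f g => Subtype.ext ((MvPowerSeries.pderiv ℂ i).leibniz f.1 g.1)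

@[simp] lemma partialDeriv_add (i : Fin 2) (f g : localRing) :
    partialDeriv i (f + g) = partialDeriv i f + partialDeriv i g :=
  map_add (partialDerivation i) f g

@[simp] lemma partialDeriv_sub (i : Fin 2) (f g : localRing) :
    partialDeriv i (f - g) = partialDeriv i f - partialDeriv i g :=
  map_sub (partialDerivation i) f g

@[simp] lemma partialDeriv_mul (i : Fin 2) (f g : localRing) :
    partialDeriv i (f * g) = f * partialDeriv i g + g * partialDeriv i f :=
  (partialDerivation i).leibniz f g

@[simp] lemma partialDeriv_pow (i : Fin 2) (f : localRing) (n : ℕ) :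
    partialDeriv i (f ^ n) = n * f ^ (n - 1) * partialDeriv i f := by
  rw [mul_assoc, ← nsmul_eq_mul]
  exact (partialDerivation i).leibniz_pow f n

@[simp] lemma partialDeriv_zero_x : partialDeriv 0 x = 1 :=
  Subtype.ext (MvPowerSeries.pderiv_X_self ..)

@[simp] lemma partialDeriv_zero_y : partialDeriv 0 y = 0 :=
  Subtype.ext (MvPowerSeries.pderiv_X_of_ne (by decide))

@[simp] lemma partialDeriv_one_x : partialDeriv 1 x = 0 :=
  Subtype.ext (MvPowerSeries.pderiv_X_of_ne (by decide))

@[simp] lemma partialDeriv_one_y : partialDeriv 1 y = 1 :=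
  Subtype.ext (MvPowerSeries.pderiv_X_self ..)

/-! ### Values near the origin -/

lemma eventually_summable_norm_value (f : localRing) :
    ∀ᶠ P : Fin 2 → ℂ in 𝓝 0,
      Summable fun n : Fin 2 →₀ ℕ => ‖MvPowerSeries.coeff n f.1 * (P 0 ^ n 0 * P 1 ^ n 1)‖ := by
  obtain ⟨r, hr, hf⟩ := f.2
  filter_upwards [Metric.ball_mem_nhds 0 hr] with P hP
  have hPr (i : Fin 2) : ‖P i‖ ≤ r := (norm_le_pi_norm P i).trans (mem_ball_zero_iff.1 hP).le
  refine Summable.of_nonneg_of_le (fun n => norm_nonneg _) (fun n => ?_) hf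
  rw [norm_mul, norm_mul, norm_pow, norm_pow, pow_add]
  gcongr
  exacts [hPr 0, hPr 1]

lemma eventually_value_add (f g : localRing) :
    ∀ᶠ P in 𝓝 0, value (f + g) P = value f P + value g P := by
  filter_upwards [eventually_summable_norm_value f, eventually_summable_norm_value g] with P hf hg
  rw [value, value, value, ← hf.of_norm.tsum_add hg.of_norm]
  exact tsum_congr fun n => add_mul ..

lemma eventually_value_mul (f g : localRing) :
    ∀ᶠ P in 𝓝 0, value (f * g) P = value f P * value g P := by
  classical
  filter_upwards [eventually_summable_norm_value f, eventually_summable_norm_value g] with P hf hg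
  have hfg := summable_mul_of_summable_norm hf hg
  refine Eq.trans (tsum_congr fun n => ?_)
    (hf.of_norm.tsum_mul_tsum_eq_tsum_sum_antidiagonal hg.of_norm hfg).symm
  rw [Subalgebra.coe_mul, MvPowerSeries.coeff_mul, Finset.sum_mul]
  refine Finset.sum_congr rfl fun p hp => ?_
  obtain rfl := Finset.HasAntidiagonal.mem_antidiagonal.mp hp
  simp only [Finsupp.add_apply, pow_add]
  ring

lemma value_xy (i j : ℕ) (P : Fin 2 → ℂ) : value (x ^ i * y ^ j) P = P 0 ^ i * P 1 ^ j := by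
  rw [value, tsum_eq_single (exponent i j)]
  · rw [coeff_val, coeff_xy]
    simp
  · intro n hn
    rw [coeff_val, coeff_xy, if_neg, zero_mul]
    rintro ⟨rfl, rfl⟩
    exact hn (exponent_eta n).symm

lemma eventually_value_eq_zero_of_mem_span_pair {f u v : localRing} (hf : f ∈ Ideal.span {u, v}) :
    ∀ᶠ P in 𝓝 0, value u P = 0 → value v P = 0 → value f P = 0 := by
  obtain ⟨c, d, rfl⟩ := Ideal.mem_span_pair.1 hf
  filter_upwards [eventually_value_add (c * u) (d * v), eventually_value_mul c u,
    eventually_value_mul d v] with P hadd hcu hdv hu hv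
  rw [hadd, hcu, hdv, hu, hv, mul_zero, mul_zero, add_zero]

/-! ### Isolated singularities -/

lemma exists_pow_mem_of_finiteDimensional {I : Ideal localRing}
    [FiniteDimensional ℂ (localRing ⧸ I)] {g : localRing} (hg : valueAtZero g = 0) :
    ∃ N, g ^ N ∈ I := by
  have : IsArtinianRing (localRing ⧸ I) := IsArtinianRing.of_finite ℂ (localRing ⧸ I)
  have hunit (c : localRing ⧸ I) : IsUnit (Ideal.Quotient.mk I g * c + 1) := by
    obtain ⟨c, rfl⟩ := Ideal.Quotient.mk_surjective c
    rw [← map_mul, ← map_one (Ideal.Quotient.mk I), ← map_add]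
    exact (isUnit_iff_valueAtZero_ne_zero.2 (by simp [hg])).map _
  have hjac := (Ideal.mem_jacobson_bot (R := localRing ⧸ I)).2 hunit
  obtain ⟨N, hN⟩ := IsArtinianRing.isNilpotent_jacobson_bot (R := localRing ⧸ I)
  refine ⟨N, Ideal.Quotient.eq_zero_iff_mem.1 ?_⟩
  rw [map_pow, ← Ideal.mem_bot, ← Ideal.zero_eq_bot, ← hN]
  exact Ideal.pow_mem_pow hjac N

theorem isIsolatedSingularity_of_finiteDimensional_milnorAlgebra {f : localRing}
    [FiniteDimensional ℂ (MilnorAlgebra f)] (h0 : valueAtZero f = 0)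
    (hd : ∀ i, valueAtZero (partialDeriv i f) = 0) : IsIsolatedSingularity f := by
  obtain ⟨M, hM⟩ := exists_pow_mem_of_finiteDimensional (I := jacobianIdeal f) valueAtZero_x
  obtain ⟨N, hN⟩ := exists_pow_mem_of_finiteDimensional (I := jacobianIdeal f) valueAtZero_y
  refine ⟨h0, hd, ?_⟩
  filter_upwards [nhdsWithin_le_nhds (eventually_value_eq_zero_of_mem_span_pair hM),
    nhdsWithin_le_nhds (eventually_value_eq_zero_of_mem_span_pair hN),
    self_mem_nhdsWithin] with P hMP hNP hne ⟨_, hP⟩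
  have hx : P 0 ^ M = 0 := by
    simpa [hMP (hP 0) (hP 1)] using (value_xy M 0 P).symm
  have hy : P 1 ^ N = 0 := by
    simpa [hNP (hP 0) (hP 1)] using (value_xy 0 N P).symm
  refine hne (funext fun i => ?_)
  fin_cases i
  exacts [eq_zero_of_pow_eq_zero hx, eq_zero_of_pow_eq_zero hy]

/-! ### Milnor and Tjurina numbers of trinomials -/

lemma hasInitialPowers_add {a b p q i j k l : ℕ} (hx : a * p < a * i + b * j)
    (hy : b * q < a * k + b * l) (c d : localRing) :
    HasInitialPowers a b p q (x ^ p + c * (x ^ i * y ^ j)) (y ^ q + d * (x ^ k * y ^ l)) where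
  left := by
    rw [add_sub_cancel_left]
    exact Ideal.mul_mem_left _ _ (xy_mem_weightIdeal hx)
  right := by
    rw [add_sub_cancel_left]
    exact Ideal.mul_mem_left _ _ (xy_mem_weightIdeal hy)

/-- The germ of a trinomial. Its Newton segment joins `x ^ (p + 1)` and `y ^ (q + 1)`, and the
exponents are shifted so that the powers `x ^ p` and `y ^ q` appear in its partial derivatives. -/
def trinomial (p q s t : ℕ) : localRing := x ^ (p + 1) + y ^ (q + 1) + x ^ s * y ^ t

/-- The exponents of a trinomial whose third monomial lies strictly above the Newton segment, and
is so far from its endpoints that the syzygies of the Jacobian ideal with `x ^ s * y ^ t` have an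
explicit form. -/
structure IsAdmissible (p q s t : ℕ) : Prop where
  s_le : s ≤ p
  t_le : t ≤ q
  le_two_mul_s : p ≤ 2 * s
  lt_two_mul_t : q + 1 < 2 * t
  above_segment : (p + 1) * (q + 1) < (q + 1) * s + (p + 1) * t

/-- The Jacobian ideal of a trinomial, with generators normalized to be monic, has this form for
`A = s / (p + 1)` and `B = t / (q + 1)`. -/
def cornerIdeal (A B : localRing) (p q s t : ℕ) : Ideal localRing :=
  Ideal.span {x ^ p + A * (x ^ (s - 1) * y ^ t), y ^ q + B * (x ^ s * y ^ (t - 1))}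

lemma xy_mul_mem_cornerIdeal_left (A B : localRing) {p q s t : ℕ} (hs : 0 < s) (hsp : s ≤ p)
    (hqt : q < 2 * t) :
    x ^ s * y ^ t * (x ^ (p - s) + -(A * B) * (x ^ (s - 1) * y ^ (2 * t - (q + 1)))) ∈
      cornerIdeal A B p q s t := by
  obtain ⟨i, rfl⟩ := Nat.exists_eq_add_of_le hsp
  obtain ⟨s, rfl⟩ := Nat.exists_eq_succ_of_ne_zero hs.ne'
  obtain ⟨l, hl⟩ := Nat.exists_eq_add_of_lt hqt
  obtain ⟨t, rfl⟩ : ∃ k, t = k + 1 := Nat.exists_eq_succ_of_ne_zero (by omega)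
  have hexp : 2 * (t + 1) - (q + 1) = l := by omega
  rw [hexp, Nat.add_sub_cancel_left]
  refine Ideal.mem_span_pair.2 ⟨y ^ (t + 1), -(A * (x ^ s * y ^ (l + 1))), ?_⟩
  have hpow : y ^ t * y ^ t * y ^ 2 = y ^ q * y ^ l * y := by
    rw [← pow_add, ← pow_add, ← pow_add, ← pow_succ]
    congr 1
    omega
  simp only [Nat.succ_eq_add_one, Nat.add_sub_cancel]
  linear_combination A * x ^ s * hpow

lemma xy_mul_mem_cornerIdeal_right (A B : localRing) {p q s t : ℕ} (hs : 0 < s)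
    (hps : p ≤ 2 * s) (ht : t ≤ q) (hqt : q + 1 < 2 * t) :
    x ^ s * y ^ t *
        (y ^ (q - t) + A * B ^ 2 * (x ^ (3 * s - (p + 1)) * y ^ (2 * t - (q + 2)))) ∈
      cornerIdeal A B p q s t := by
  obtain ⟨j, rfl⟩ := Nat.exists_eq_add_of_le ht
  obtain ⟨l, rfl⟩ : ∃ l, t = j + l + 2 := ⟨t - (j + 2), by omega⟩
  obtain ⟨s, rfl⟩ := Nat.exists_eq_succ_of_ne_zero hs.ne'
  obtain ⟨k, hk⟩ := Nat.exists_eq_add_of_le hps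
  have hx : 3 * (s + 1) - (p + 1) = s + k := by omega
  have hy : 2 * (j + l + 2) - (j + l + 2 + j + 2) = l := by omega
  rw [Nat.succ_eq_add_one, hx, hy, Nat.add_sub_cancel_left]
  refine Ideal.mem_span_pair.2 ⟨-(B * (x ^ k * y ^ (j + l + 1))),
    x ^ (s + 1) + A * B * (x ^ (s + k) * y ^ (l + 1)), ?_⟩
  have hpow : x ^ p * x ^ k = x ^ (2 * s + 2) := by
    rw [← pow_add, ← hk]
    rfl
  simp only [Nat.add_sub_cancel, Nat.add_succ_sub_one]
  linear_combination -(B * y ^ (j + l + 1)) * hpow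

namespace IsAdmissible

variable {p q s t : ℕ}

lemma s_pos (h : IsAdmissible p q s t) : 0 < s := by
  by_contra! hs
  obtain rfl : s = 0 := by omega
  nlinarith [h.above_segment, h.t_le]

lemma t_pos (h : IsAdmissible p q s t) : 0 < t := by
  have := h.lt_two_mul_t
  omega

lemma hasInitialPowers_corners (h : IsAdmissible p q s t) (A B : localRing) :
    HasInitialPowers (q + 1) (p + 1) p q (x ^ p + A * (x ^ (s - 1) * y ^ t))
      (y ^ q + B * (x ^ s * y ^ (t - 1))) := by
  have := h.above_segment
  obtain ⟨s, rfl⟩ : ∃ k, s = k + 1 := Nat.exists_eq_succ_of_ne_zero h.s_pos.ne'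
  obtain ⟨t, rfl⟩ : ∃ k, t = k + 1 := Nat.exists_eq_succ_of_ne_zero h.t_pos.ne'
  refine hasInitialPowers_add ?_ ?_ A B <;>
    rw [Nat.add_sub_cancel] <;> nlinarith

lemma hasInitialPowers_quotients (h : IsAdmissible p q s t) (A B : localRing) :
    HasInitialPowers (q + 1) (p + 1) (p - s) (q - t)
      (x ^ (p - s) + A * (x ^ (s - 1) * y ^ (2 * t - (q + 1))))
      (y ^ (q - t) + B * (x ^ (3 * s - (p + 1)) * y ^ (2 * t - (q + 2)))) := by
  have hs := h.s_pos
  have hst := h.above_segment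
  obtain ⟨h1, h2, h3, h4, -⟩ := h
  zify at hst
  refine hasInitialPowers_add ?_ ?_ A B
  · zify [h1, Nat.succ_le_of_lt hs, h4.le]
    nlinarith
  · zify [h2, (by omega : p + 1 ≤ 3 * s), Nat.succ_le_of_lt h4]
    nlinarith

theorem isCompl_cornerIdeal (h : IsAdmissible p q s t) (A B : localRing) :
    IsCompl (monomialSpan (Finset.range p ×ˢ Finset.range q : Finset (ℕ × ℕ)))
      ((cornerIdeal A B p q s t).restrictScalars ℂ) :=
  (h.hasInitialPowers_corners A B).isCompl_monomialSpan_span_pair q.succ_pos p.succ_pos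

theorem isCompl_span_sup_cornerIdeal (h : IsAdmissible p q s t) (A B : localRing) :
    IsCompl
      (monomialSpan ((Finset.range p ×ˢ Finset.range q) \ (Finset.Ico s p ×ˢ Finset.Ico t q) :
        Finset (ℕ × ℕ)))
      ((Ideal.span {x ^ s * y ^ t} ⊔ cornerIdeal A B p q s t).restrictScalars ℂ) :=
  (h.hasInitialPowers_corners A B).isCompl_monomialSpan_sdiff (h.hasInitialPowers_quotients _ _)
    q.succ_pos p.succ_pos
    (xy_mul_mem_cornerIdeal_left A B h.s_pos h.s_le (by have := h.lt_two_mul_t; omega))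
    (xy_mul_mem_cornerIdeal_right A B h.s_pos h.le_two_mul_s h.t_le h.lt_two_mul_t)

end IsAdmissible

section Trinomial

variable (p q s t : ℕ)

lemma partialDeriv_zero_trinomial :
    partialDeriv 0 (trinomial p q s t) = algebraMap ℂ localRing (p + 1) *
      (x ^ p + algebraMap ℂ localRing (s / (p + 1)) * (x ^ (s - 1) * y ^ t)) := by
  rw [mul_add, ← mul_assoc, ← map_mul, mul_div_cancel₀ _ p.cast_add_one_ne_zero]
  simp only [trinomial, partialDeriv_add, partialDeriv_mul, partialDeriv_pow, partialDeriv_zero_x,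
    partialDeriv_zero_y, Nat.cast_succ, Nat.add_sub_cancel, map_add, map_natCast, map_one]
  ring

lemma partialDeriv_one_trinomial :
    partialDeriv 1 (trinomial p q s t) = algebraMap ℂ localRing (q + 1) *
      (y ^ q + algebraMap ℂ localRing (t / (q + 1)) * (x ^ s * y ^ (t - 1))) := by
  rw [mul_add, ← mul_assoc, ← map_mul, mul_div_cancel₀ _ q.cast_add_one_ne_zero]
  simp only [trinomial, partialDeriv_add, partialDeriv_mul, partialDeriv_pow, partialDeriv_one_x,
    partialDeriv_one_y, Nat.cast_succ, Nat.add_sub_cancel, map_add, map_natCast, map_one]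
  ring

lemma jacobianIdeal_trinomial :
    jacobianIdeal (trinomial p q s t) =
      cornerIdeal (algebraMap ℂ localRing (s / (p + 1))) (algebraMap ℂ localRing (t / (q + 1)))
        p q s t := by
  have hunit (n : ℕ) : IsUnit (algebraMap ℂ localRing (n + 1)) :=
    (IsUnit.mk0 _ n.cast_add_one_ne_zero).map _
  rw [jacobianIdeal, partialDeriv_zero_trinomial, partialDeriv_one_trinomial, Ideal.span_insert,
    Ideal.span_singleton_mul_left_unit (hunit p), Ideal.span_singleton_mul_left_unit (hunit q),
    ← Ideal.span_insert, cornerIdeal]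

end Trinomial

lemma span_singleton_sup_eq_of_sub_mem {R : Type*} [CommRing R] {J : Ideal R} {c f w : R}
    (hc : IsUnit c) (h : f - c * w ∈ J) : Ideal.span {f} ⊔ J = Ideal.span {w} ⊔ J := by
  rw [← Ideal.span_singleton_mul_left_unit hc w]
  refine le_antisymm (sup_le ?_ le_sup_right) (sup_le ?_ le_sup_right) <;>
    rw [Ideal.span_singleton_le_iff_mem]
  · rw [← add_sub_cancel (c * w) f]
    exact Submodule.add_mem_sup (Ideal.mem_span_singleton_self _) h
  · rw [← sub_sub_cancel f (c * w)]
    exact Submodule.sub_mem _ (Ideal.mem_sup_left (Ideal.mem_span_singleton_self f))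
      (Ideal.mem_sup_right h)

namespace IsAdmissible

variable {p q s t : ℕ}

/-- Euler's formula for the weights of the Newton segment. -/
lemma span_trinomial_sup_jacobianIdeal (h : IsAdmissible p q s t) :
    Ideal.span {trinomial p q s t} ⊔ jacobianIdeal (trinomial p q s t) =
      Ideal.span {x ^ s * y ^ t} ⊔ jacobianIdeal (trinomial p q s t) := by
  have hp : (p + 1 : ℂ) ≠ 0 := p.cast_add_one_ne_zero
  have hq : (q + 1 : ℂ) ≠ 0 := q.cast_add_one_ne_zero
  have hγ : 1 - s / (p + 1 : ℂ) - t / (q + 1 : ℂ) ≠ 0 := by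
    have habove : ((p + 1) * (q + 1) : ℂ) ≠ (q + 1) * s + (p + 1) * t :=
      mod_cast h.above_segment.ne
    contrapose! habove
    field_simp at habove
    linear_combination habove
  refine span_singleton_sup_eq_of_sub_mem ((IsUnit.mk0 _ hγ).map (algebraMap ℂ localRing)) ?_
  rw [jacobianIdeal_trinomial, cornerIdeal, map_sub, map_sub, map_one]
  refine Ideal.mem_span_pair.2 ⟨x, y, ?_⟩
  obtain ⟨s, rfl⟩ : ∃ k, s = k + 1 := Nat.exists_eq_succ_of_ne_zero h.s_pos.ne'
  obtain ⟨t, rfl⟩ : ∃ k, t = k + 1 := Nat.exists_eq_succ_of_ne_zero h.t_pos.ne'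
  rw [trinomial, Nat.add_sub_cancel, Nat.add_sub_cancel]
  ring

theorem finiteDimensional_milnorAlgebra (h : IsAdmissible p q s t) :
    FiniteDimensional ℂ (MilnorAlgebra (trinomial p q s t)) :=
  finiteDimensional_quotient_of_isCompl (jacobianIdeal_trinomial p q s t ▸ h.isCompl_cornerIdeal ..)

theorem milnorNumber_eq (h : IsAdmissible p q s t) : milnorNumber (trinomial p q s t) = p * q := by
  rw [milnorNumber, finrank_quotient_of_isCompl
    (jacobianIdeal_trinomial p q s t ▸ h.isCompl_cornerIdeal ..)]
  simp

lemma isCompl_tjurinaIdeal (h : IsAdmissible p q s t) :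
    IsCompl
      (monomialSpan ((Finset.range p ×ˢ Finset.range q) \ (Finset.Ico s p ×ˢ Finset.Ico t q) :
        Finset (ℕ × ℕ)))
      ((Ideal.span {trinomial p q s t} ⊔ jacobianIdeal (trinomial p q s t)).restrictScalars ℂ) := by
  rw [h.span_trinomial_sup_jacobianIdeal, jacobianIdeal_trinomial]
  exact h.isCompl_span_sup_cornerIdeal ..

theorem finiteDimensional_tjurinaAlgebra (h : IsAdmissible p q s t) :
    FiniteDimensional ℂ (TjurinaAlgebra (trinomial p q s t)) :=
  finiteDimensional_quotient_of_isCompl h.isCompl_tjurinaIdeal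

theorem tjurinaNumber_add (h : IsAdmissible p q s t) :
    tjurinaNumber (trinomial p q s t) + (p - s) * (q - t) = p * q := by
  have hsub : Finset.Ico s p ×ˢ Finset.Ico t q ⊆ Finset.range p ×ˢ Finset.range q :=
    Finset.product_subset_product (by simp [Finset.subset_iff]) (by simp [Finset.subset_iff])
  have hcard := Finset.card_sdiff_add_card_eq_card hsub
  rw [tjurinaNumber, finrank_quotient_of_isCompl h.isCompl_tjurinaIdeal]
  simpa using hcard

theorem isIsolatedSingularity (h : IsAdmissible p q s t) :
    IsIsolatedSingularity (trinomial p q s t) := by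
  have := h.finiteDimensional_milnorAlgebra
  have ht0 := h.t_pos.ne'
  have hp0 : p ≠ 0 := (h.s_pos.trans_le h.s_le).ne'
  have hq0 : q ≠ 0 := (h.t_pos.trans_le h.t_le).ne'
  refine isIsolatedSingularity_of_finiteDimensional_milnorAlgebra ?_ fun i => ?_
  · simp [trinomial, ht0]
  · have ht1 : t - 1 ≠ 0 := by have := h.lt_two_mul_t; omega
    fin_cases i <;>
      simp [partialDeriv_zero_trinomial, partialDeriv_one_trinomial, hp0, hq0, ht0, ht1]

end IsAdmissible

/-! ### Irreducibility -/

lemma exists_coeff_ne_zero_of_coeff_mul_ne_zero {i j : ℕ} {g h : localRing}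
    (hgh : coeff i j (g * h) ≠ 0) :
    ∃ i₁ j₁ i₂ j₂, i₁ + i₂ = i ∧ j₁ + j₂ = j ∧ coeff i₁ j₁ g ≠ 0 ∧ coeff i₂ j₂ h ≠ 0 := by
  classical
  have hmul : MvPowerSeries.coeff (exponent i j) (g.1 * h.1) ≠ 0 := hgh
  rw [MvPowerSeries.coeff_mul] at hmul
  obtain ⟨⟨m, n⟩, hmn, hne⟩ := Finset.exists_ne_zero_of_sum_ne_zero hmul
  rw [Finset.HasAntidiagonal.mem_antidiagonal] at hmn
  rw [coeff_val, coeff_val] at hne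
  exact ⟨m 0, m 1, n 0, n 1, by simpa using DFunLike.congr_fun hmn 0,
    by simpa using DFunLike.congr_fun hmn 1, left_ne_zero_of_mul hne, right_ne_zero_of_mul hne⟩

lemma exists_mem_weightIdeal_of_mul_mem {a b k : ℕ} {g h : localRing}
    (hgh : g * h ∈ weightIdeal a b k) :
    ∃ l m, k ≤ l + m ∧ g ∈ weightIdeal a b l ∧ h ∈ weightIdeal a b m := by
  have hk : (k : ℕ∞) ≤ g.1.weightedOrder ![a, b] + h.1.weightedOrder ![a, b] := by
    rw [← MvPowerSeries.weightedOrder_mul]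
    exact hgh
  simp only [mem_weightIdeal_iff_le_weightedOrder]
  generalize g.1.weightedOrder ![a, b] = A at hk ⊢
  generalize h.1.weightedOrder ![a, b] = B at hk ⊢
  induction A using ENat.recTopCoe with
  | top => exact ⟨k, 0, le_rfl, le_top, zero_le⟩
  | coe A =>
    induction B using ENat.recTopCoe with
    | top => exact ⟨0, k, (zero_add k).ge, zero_le, le_top⟩
    | coe B => exact ⟨A, B, mod_cast hk, le_rfl, le_rfl⟩

/-- The initial form for the weights `(q, p)` is `x ^ p + c * y ^ q` up to a constant, so a factor
of weight `k` contains both `x ^ (k / q)` and `y ^ (k / p)`, which forces `p * q ∣ k`. -/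
theorem irreducible_of_mem_weightIdeal {p q : ℕ} (hp : 0 < p) (hq : 0 < q) (hpq : p.Coprime q)
    {f : localRing} (hf : f ∈ weightIdeal q p (p * q)) (hx : coeff p 0 f ≠ 0)
    (hy : coeff 0 q f ≠ 0) : Irreducible f := by
  refine ⟨fun hunit => isUnit_iff_valueAtZero_ne_zero.1 hunit ?_, ?_⟩
  · rw [← coeff_zero_zero]
    exact mem_weightIdeal.1 hf 0 0 (by simp [hp, hq])
  rintro g h rfl
  have hunit {g : localRing} {i : ℕ} (hi : i = 0) (hg : coeff 0 i g ≠ 0) : IsUnit g := by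
    subst hi
    rwa [coeff_zero_zero, ← isUnit_iff_valueAtZero_ne_zero] at hg
  obtain ⟨l, m, hlm, hgl, hhm⟩ := exists_mem_weightIdeal_of_mul_mem hf
  obtain ⟨i₁, j₁, i₂, j₂, rfl, hj, hg, hh⟩ := exists_coeff_ne_zero_of_coeff_mul_ne_zero hx
  obtain ⟨rfl, rfl⟩ : j₁ = 0 ∧ j₂ = 0 := by omega
  obtain ⟨i₁', j₁, i₂', j₂, hi, rfl, hg', hh'⟩ := exists_coeff_ne_zero_of_coeff_mul_ne_zero hy
  obtain ⟨rfl, rfl⟩ : i₁' = 0 ∧ i₂' = 0 := by omega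
  have hgx := not_lt.1 (mt (mem_weightIdeal.1 hgl _ _) hg)
  have hhx := not_lt.1 (mt (mem_weightIdeal.1 hhm _ _) hh)
  have hgy := not_lt.1 (mt (mem_weightIdeal.1 hgl _ _) hg')
  have hhy := not_lt.1 (mt (mem_weightIdeal.1 hhm _ _) hh')
  have hinitial : (j₁ + j₂) * i₁ = (i₁ + i₂) * j₁ := by nlinarith
  have hdvd : j₁ + j₂ ∣ j₁ := hpq.symm.dvd_of_dvd_mul_left ⟨i₁, hinitial.symm⟩
  rcases j₁.eq_zero_or_pos with hj₁ | hj₁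
  · exact Or.inl (hunit hj₁ hg')
  · exact Or.inr (hunit (by have := Nat.le_of_dvd hj₁ hdvd; omega) hh')

/-! ### Smooth transversal branches -/

lemma IsSmoothGerm.irreducible {g : localRing} (hg : IsSmoothGerm g) : Irreducible g := by
  obtain ⟨h0, i, hi⟩ := hg
  refine ⟨fun hunit => isUnit_iff_valueAtZero_ne_zero.1 hunit h0, ?_⟩
  rintro a b rfl
  contrapose! hi
  simp only [isUnit_iff_valueAtZero_ne_zero, not_not] at hi
  simp [hi.1, hi.2]

lemma valueAtZero_partialDeriv_x_sub_y_mul (t : localRing) (i : Fin 2) :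
    valueAtZero (partialDeriv i (x - y * t)) = ![1, -valueAtZero t] i := by
  fin_cases i <;> simp

lemma isSmoothGerm_x_sub_y_mul (t : localRing) : IsSmoothGerm (x - y * t) :=
  ⟨by simp, 0, by simp⟩

lemma hasDistinctTangents_x_sub_y_mul {t u : localRing} (h : valueAtZero t ≠ valueAtZero u) :
    HasDistinctTangents (x - y * t) (x - y * u) := by
  simp only [HasDistinctTangents, valueAtZero_partialDeriv_x_sub_y_mul]
  refine LinearIndependent.pair_iff.2 fun c d hcd => ?_
  have h0 : c + d = 0 := by simpa using congrFun hcd 0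
  have h1 : -(c * valueAtZero t) + -(d * valueAtZero u) = 0 := by simpa using congrFun hcd 1
  have hc : c = 0 := by
    have : c * (valueAtZero t - valueAtZero u) = 0 := by
      linear_combination -h1 - valueAtZero u * h0
    exact (mul_eq_zero.1 this).resolve_right (sub_ne_zero.2 h)
  exact ⟨hc, by simpa [hc] using h0⟩

section Factorization

open Polynomial

lemma eq_prod_X_sub_C_of_monic_of_injective {R ι : Type*} [CommRing R] [IsDomain R] [Fintype ι]
    {P : R[X]} (hP : P.Monic) {t : ι → R} (ht : Function.Injective t)
    (hcard : P.natDegree = Fintype.card ι) (hroot : ∀ j, P.IsRoot (t j)) :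
    P = ∏ j, (X - C (t j)) := by
  have hle : Finset.univ.val.map t ≤ P.roots :=
    (Multiset.le_iff_subset (Finset.univ.nodup.map ht)).2 fun a ha => by
      obtain ⟨j, -, rfl⟩ := Multiset.mem_map.1 ha
      exact (mem_roots hP.ne_zero).2 (hroot j)
  have hroots : Finset.univ.val.map t = P.roots :=
    Multiset.eq_of_le_of_card_le hle (P.card_roots'.trans (by simp [hcard]))
  rw [← prod_multiset_X_sub_C_of_monic_of_roots_card_eq hP (by simp [← hroots, hcard]), ← hroots,
    Multiset.map_map]
  rfl

instance : IsDomain localRing := NoZeroDivisors.to_isDomain _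

lemma valueAtZero_eval_algebraMap (P : localRing[X]) (c : ℂ) :
    valueAtZero (P.eval (algebraMap ℂ localRing c)) =
      (P.map (valueAtZeroHom : localRing →+* ℂ)).eval c := by
  simpa [valueAtZeroHom_apply] using
    (eval_map_apply (valueAtZeroHom : localRing →+* ℂ) (algebraMap ℂ localRing c) (p := P)).symm

theorem exists_eq_prod_X_sub_C_of_separable {P : localRing[X]} (hP : P.Monic)
    (hsep : (P.map (valueAtZeroHom : localRing →+* ℂ)).Separable) :
    ∃ t : Fin P.natDegree → localRing, Function.Injective (fun j => valueAtZero (t j)) ∧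
      P = ∏ j, (X - C (t j)) := by
  set Q := P.map (valueAtZeroHom : localRing →+* ℂ)
  have hcard : Q.roots.toFinset.card = P.natDegree := by
    rw [Multiset.toFinset_card_of_nodup (nodup_roots hsep), ← hP.natDegree_map
      (valueAtZeroHom : localRing →+* ℂ)]
    exact (IsAlgClosed.splits Q).natDegree_eq_card_roots.symm
  have hlift (j : Fin P.natDegree) : ∃ t, valueAtZero t =
      (Q.roots.toFinset.equivFinOfCardEq hcard).symm j ∧ P.eval t = 0 := by
    set ω := (Q.roots.toFinset.equivFinOfCardEq hcard).symm j
    have hω : Q.IsRoot ω := isRoot_of_mem_roots (Multiset.mem_toFinset.1 ω.2)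
    obtain ⟨t, ht, hPt⟩ := exists_root_of_simple_root P (algebraMap ℂ localRing ω)
      (by rw [valueAtZero_eval_algebraMap, hω])
      (by
        rw [valueAtZero_eval_algebraMap, ← derivative_map]
        exact hsep.aeval_derivative_ne_zero hω)
    exact ⟨t, by simpa using ht, hPt⟩
  choose t ht hPt using hlift
  have hinj : Function.Injective fun j => valueAtZero (t j) := by
    simp only [ht]
    exact Subtype.val_injective.comp (Equiv.injective _)
  exact ⟨t, hinj, eq_prod_X_sub_C_of_monic_of_injective hP (hinj.of_comp (f := valueAtZero))
    (by simp) hPt⟩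

/-- The homogenization of `P` is the product of the `x - y * t` over the roots `t` of `P`. -/
theorem hasSmoothTransversalBranches_eval_scaleRoots {P : localRing[X]} (hP : P.Monic)
    (hsep : (P.map (valueAtZeroHom : localRing →+* ℂ)).Separable) :
    HasSmoothTransversalBranches ((P.scaleRoots y).eval x) := by
  obtain ⟨t, hinj, hprod⟩ := exists_eq_prod_X_sub_C_of_separable hP hsep
  have hscale : ∏ j, (x - y * t j) = (P.scaleRoots y).eval x := by
    let φ : localRing[X] →* localRing :=
      { toFun S := (S.scaleRoots y).eval x
        map_one' := by simp
        map_mul' S T := by rw [mul_scaleRoots_of_noZeroDivisors, eval_mul] }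
    have := congrArg φ hprod
    rw [map_prod] at this
    simpa [φ, mul_comm y] using this.symm
  exact ⟨P.natDegree, fun j => x - y * t j, hscale ▸ Associated.refl _,
    fun j => (isSmoothGerm_x_sub_y_mul _).irreducible, fun j => isSmoothGerm_x_sub_y_mul _,
    fun j k hjk => hasDistinctTangents_x_sub_y_mul (hinj.ne hjk)⟩

end Factorization

/-! ### The two families -/

section IrreducibleFamily

variable {m : ℕ}

lemma irreducibleFamily_eq_trinomial (hm : 1 ≤ m) :
    irreducibleFamily m = trinomial (2 * m) (2 * m - 1) m (m + 1) := by
  rw [irreducibleFamily, trinomial, Nat.sub_add_cancel (by omega)]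
  ring

lemma isAdmissible_irreducibleFamily (hm : 2 ≤ m) :
    IsAdmissible (2 * m) (2 * m - 1) m (m + 1) := by
  obtain ⟨k, rfl⟩ := Nat.exists_eq_add_of_le' hm
  refine ⟨by omega, by omega, by omega, by omega, ?_⟩
  rw [Nat.sub_add_cancel (by omega)]
  nlinarith

theorem isIsolatedSingularity_irreducibleFamily (hm : 2 ≤ m) :
    IsIsolatedSingularity (irreducibleFamily m) := by
  rw [irreducibleFamily_eq_trinomial (by omega)]
  exact (isAdmissible_irreducibleFamily hm).isIsolatedSingularity

theorem finiteDimensional_milnorAlgebra_irreducibleFamily (hm : 2 ≤ m) :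
    FiniteDimensional ℂ (MilnorAlgebra (irreducibleFamily m)) := by
  rw [irreducibleFamily_eq_trinomial (by omega)]
  exact (isAdmissible_irreducibleFamily hm).finiteDimensional_milnorAlgebra

theorem finiteDimensional_tjurinaAlgebra_irreducibleFamily (hm : 2 ≤ m) :
    FiniteDimensional ℂ (TjurinaAlgebra (irreducibleFamily m)) := by
  rw [irreducibleFamily_eq_trinomial (by omega)]
  exact (isAdmissible_irreducibleFamily hm).finiteDimensional_tjurinaAlgebra

theorem milnorNumber_irreducibleFamily (hm : 2 ≤ m) :
    (milnorNumber (irreducibleFamily m) : ℤ) = 2 * m * (2 * m - 1) := by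
  rw [irreducibleFamily_eq_trinomial (by omega),
    (isAdmissible_irreducibleFamily hm).milnorNumber_eq, Nat.cast_mul, Nat.cast_sub (by omega)]
  push_cast
  ring

theorem tjurinaNumber_irreducibleFamily (hm : 2 ≤ m) :
    tjurinaNumber (irreducibleFamily m) = 3 * m ^ 2 := by
  have h := (isAdmissible_irreducibleFamily hm).tjurinaNumber_add
  rw [← irreducibleFamily_eq_trinomial (by omega)] at h
  obtain ⟨k, rfl⟩ := Nat.exists_eq_add_of_le' hm
  rw [show 2 * (k + 2) - (k + 2) = k + 2 by omega,
    show 2 * (k + 2) - 1 - (k + 2 + 1) = k by omega,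
    show 2 * (k + 2) - 1 = 2 * k + 3 by omega] at h
  linarith

lemma coeff_irreducibleFamily (i j : ℕ) :
    coeff i j (irreducibleFamily m) = (if i = 2 * m + 1 ∧ j = 0 then 1 else 0) +
      (if i = m ∧ j = m + 1 then 1 else 0) + if i = 0 ∧ j = 2 * m then 1 else 0 := by
  have hx : x ^ (2 * m + 1) = x ^ (2 * m + 1) * y ^ 0 := by rw [pow_zero, mul_one]
  have hy : y ^ (2 * m) = x ^ 0 * y ^ (2 * m) := by rw [pow_zero, one_mul]
  rw [irreducibleFamily, hx, hy, map_add, map_add, coeff_xy, coeff_xy, coeff_xy]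

theorem irreducible_irreducibleFamily (hm : 1 ≤ m) : Irreducible (irreducibleFamily m) := by
  refine irreducible_of_mem_weightIdeal (p := 2 * m + 1) (q := 2 * m) (by omega) (by omega)
    (by simp) (mem_weightIdeal.2 fun i j hij => ?_) ?_ ?_
  · rw [coeff_irreducibleFamily, if_neg, if_neg, if_neg, add_zero, add_zero] <;>
      rintro ⟨rfl, rfl⟩ <;> nlinarith
  · simp [coeff_irreducibleFamily]
  · rw [coeff_irreducibleFamily, if_neg (by omega), if_neg (by omega)]
    simp

lemma rho_irreducibleFamily (hm : 2 ≤ m) :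
    rho (irreducibleFamily m) = 4 / 3 - 2 / (3 * m) := by
  have hμ : (milnorNumber (irreducibleFamily m) : ℚ) = 2 * m * (2 * m - 1) :=
    mod_cast milnorNumber_irreducibleFamily hm
  have hm0 : (m : ℚ) ≠ 0 := Nat.cast_ne_zero.2 (by omega)
  rw [rho, hμ, tjurinaNumber_irreducibleFamily hm]
  push_cast
  field_simp
  ring

theorem strictMonoOn_rho_irreducibleFamily :
    StrictMonoOn (fun m : ℕ => rho (irreducibleFamily m)) (Set.Ici 2) := by
  intro m hm n hn hmn
  rw [Set.mem_Ici] at hm hn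
  simp only [rho_irreducibleFamily hm, rho_irreducibleFamily hn]
  have : (0 : ℚ) < m := Nat.cast_pos.2 (by omega)
  gcongr

theorem tendsto_rho_irreducibleFamily :
    Tendsto (fun m : ℕ => (rho (irreducibleFamily m) : ℝ)) atTop (𝓝 (4 / 3)) := by
  have hlim : Tendsto (fun m : ℕ => (4 / 3 : ℝ) - 2 / 3 * (1 / m)) atTop (𝓝 (4 / 3)) := by
    simpa using ((tendsto_one_div_atTop_nhds_zero_nat (𝕜 := ℝ)).const_mul (2 / 3)).const_sub (4 / 3)
  refine hlim.congr' ?_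
  filter_upwards [eventually_ge_atTop 2] with m hm
  rw [rho_irreducibleFamily hm]
  push_cast
  rw [div_mul_div_comm, mul_one]

end IrreducibleFamily

section TransversalFamily

variable {m : ℕ}

lemma transversalFamily_eq_trinomial (m : ℕ) :
    transversalFamily m = trinomial (2 * m) (2 * m) (m + 1) (m + 1) := rfl

lemma isAdmissible_transversalFamily (hm : 1 ≤ m) :
    IsAdmissible (2 * m) (2 * m) (m + 1) (m + 1) :=
  ⟨by omega, by omega, by omega, by omega, by nlinarith⟩

theorem isIsolatedSingularity_transversalFamily (hm : 1 ≤ m) :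
    IsIsolatedSingularity (transversalFamily m) :=
  (isAdmissible_transversalFamily hm).isIsolatedSingularity

theorem finiteDimensional_milnorAlgebra_transversalFamily (hm : 1 ≤ m) :
    FiniteDimensional ℂ (MilnorAlgebra (transversalFamily m)) :=
  (isAdmissible_transversalFamily hm).finiteDimensional_milnorAlgebra

theorem finiteDimensional_tjurinaAlgebra_transversalFamily (hm : 1 ≤ m) :
    FiniteDimensional ℂ (TjurinaAlgebra (transversalFamily m)) :=
  (isAdmissible_transversalFamily hm).finiteDimensional_tjurinaAlgebra

theorem milnorNumber_transversalFamily (hm : 1 ≤ m) :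
    milnorNumber (transversalFamily m) = 4 * m ^ 2 := by
  rw [transversalFamily_eq_trinomial, (isAdmissible_transversalFamily hm).milnorNumber_eq]
  ring

theorem tjurinaNumber_transversalFamily (hm : 1 ≤ m) :
    (tjurinaNumber (transversalFamily m) : ℤ) = 4 * m ^ 2 - (m - 1) ^ 2 := by
  have h := (isAdmissible_transversalFamily hm).tjurinaNumber_add
  rw [← transversalFamily_eq_trinomial, show 2 * m - (m + 1) = m - 1 by omega] at h
  zify [hm] at h
  linear_combination h

open Polynomial in
theorem hasSmoothTransversalBranches_transversalFamily (hm : 1 ≤ m) :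
    HasSmoothTransversalBranches (transversalFamily m) := by
  set L : localRing[X] := C y * X ^ (m + 1) + 1
  have hL : L.degree < (2 * m + 1 : ℕ) :=
    (degree_add_le_of_degree_le (degree_C_mul_X_pow_le (m + 1) y)
      (degree_one_le.trans (mod_cast zero_le))).trans_lt (mod_cast (by omega))
  have hP : (X ^ (2 * m + 1) + L).Monic := monic_X_pow_add hL
  have hdeg : (X ^ (2 * m + 1) + L).natDegree = 2 * m + 1 := by
    rw [natDegree_add_eq_left_of_degree_lt (by rwa [degree_X_pow]), natDegree_X_pow]
  have hsep : ((X ^ (2 * m + 1) + L).map (valueAtZeroHom : localRing →+* ℂ)).Separable := by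
    have hred : (X ^ (2 * m + 1) + L).map (valueAtZeroHom : localRing →+* ℂ) =
        X ^ (2 * m + 1) - C (-1) := by
      simp [L, valueAtZeroHom_apply]
    rw [hred]
    exact separable_X_pow_sub_C _ (Nat.cast_ne_zero.2 (by omega)) (by simp)
  have hscale : (X ^ (2 * m + 1) + L).scaleRoots y =
      X ^ (2 * m + 1) + C (y ^ (m + 1)) * X ^ (m + 1) + C (y ^ (2 * m + 1)) := by
    ext1 i
    rw [coeff_scaleRoots, hdeg]
    simp only [L, coeff_add, coeff_X_pow, coeff_C_mul, coeff_one, coeff_C]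
    rcases eq_or_ne i (2 * m + 1) with rfl | h1
    · simp [show m ≠ 0 by omega, show 2 * m ≠ m by omega]
    rcases eq_or_ne i (m + 1) with rfl | h2
    · rw [show 2 * m + 1 - (m + 1) = m by omega]
      simp [pow_succ', show m ≠ 2 * m by omega]
    · rcases eq_or_ne i 0 with rfl | h3 <;> simp [*]
  have hbranches := hasSmoothTransversalBranches_eval_scaleRoots hP hsep
  rw [hscale] at hbranches
  convert hbranches using 1
  simp only [transversalFamily, eval_add, eval_mul, eval_pow, eval_X, eval_C]
  ring

lemma rho_transversalFamily (hm : 1 ≤ m) :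
    rho (transversalFamily m) = 4 / (4 - (1 - 1 / m) ^ 2) := by
  have hτ : (tjurinaNumber (transversalFamily m) : ℚ) = 4 * m ^ 2 - (m - 1) ^ 2 :=
    mod_cast tjurinaNumber_transversalFamily hm
  have hm0 : (m : ℚ) ≠ 0 := Nat.cast_ne_zero.2 (by omega)
  have hτ' : (4 * m ^ 2 - (m - 1) ^ 2 : ℚ) = m ^ 2 * (4 - (1 - 1 / m) ^ 2) := by
    field_simp
  rw [rho, hτ, hτ', milnorNumber_transversalFamily hm, Nat.cast_mul, Nat.cast_pow, mul_comm,
    mul_div_mul_left _ _ (pow_ne_zero 2 hm0), Nat.cast_ofNat]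

theorem strictMonoOn_rho_transversalFamily :
    StrictMonoOn (fun m : ℕ => rho (transversalFamily m)) (Set.Ici 1) := by
  intro m hm n hn hmn
  rw [Set.mem_Ici] at hm hn
  simp only [rho_transversalFamily hm, rho_transversalFamily hn]
  have hm0 : (0 : ℚ) < m := Nat.cast_pos.2 (by omega)
  have hn0 : (0 : ℚ) < 1 / n := one_div_pos.2 (Nat.cast_pos.2 (by omega))
  have hm1 : (1 : ℚ) / m ≤ 1 := (div_le_one hm0).2 (mod_cast hm)
  have hnm : (1 : ℚ) / n < 1 / m := by gcongr
  refine div_lt_div_of_pos_left (by norm_num) ?_ ?_ <;> nlinarith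

theorem tendsto_rho_transversalFamily :
    Tendsto (fun m : ℕ => (rho (transversalFamily m) : ℝ)) atTop (𝓝 (4 / 3)) := by
  have hlim : Tendsto (fun m : ℕ => (4 : ℝ) / (4 - (1 - 1 / m) ^ 2)) atTop
      (𝓝 (4 / (4 - (1 - 0) ^ 2))) :=
    tendsto_const_nhds.div
      (((tendsto_one_div_atTop_nhds_zero_nat.const_sub 1).pow 2).const_sub 4) (by norm_num)
  rw [show (4 : ℝ) / (4 - (1 - 0) ^ 2) = 4 / 3 by norm_num] at hlim
  refine hlim.congr' ?_
  filter_upwards [eventually_ge_atTop 1] with m hm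
  rw [rho_transversalFamily hm]
  push_cast
  rfl

end TransversalFamily

end

end PlaneCurve

theorem mainTheorem2 :
    -- existence of a sequence with `ρ` strictly increasing to `4/3`
    (∃ f : ℕ → PlaneCurve.localRing,
      (∀ k, PlaneCurve.IsIsolatedSingularity (f k) ∧
        FiniteDimensional ℂ (PlaneCurve.MilnorAlgebra (f k)) ∧
        FiniteDimensional ℂ (PlaneCurve.TjurinaAlgebra (f k))) ∧
      StrictMono (fun k => PlaneCurve.rho (f k)) ∧
      Tendsto (fun k => (PlaneCurve.rho (f k) : ℝ)) atTop (𝓝 (4 / 3))) ∧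
    -- the irreducible family, `m ≥ 2`
    ((∀ m : ℕ, 2 ≤ m →
        PlaneCurve.IsIsolatedSingularity (PlaneCurve.irreducibleFamily m) ∧
        Irreducible (PlaneCurve.irreducibleFamily m) ∧
        FiniteDimensional ℂ (PlaneCurve.MilnorAlgebra (PlaneCurve.irreducibleFamily m)) ∧
        FiniteDimensional ℂ (PlaneCurve.TjurinaAlgebra (PlaneCurve.irreducibleFamily m)) ∧
        PlaneCurve.tjurinaNumber (PlaneCurve.irreducibleFamily m) = 3 * m ^ 2 ∧
        (PlaneCurve.milnorNumber (PlaneCurve.irreducibleFamily m) : ℤ)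
          = 2 * (m : ℤ) * (2 * (m : ℤ) - 1)) ∧
      StrictMonoOn (fun m : ℕ => PlaneCurve.rho (PlaneCurve.irreducibleFamily m)) (Set.Ici 2) ∧
      Tendsto (fun m : ℕ => (PlaneCurve.rho (PlaneCurve.irreducibleFamily m) : ℝ))
        atTop (𝓝 (4 / 3))) ∧
    -- the family with smooth branches and distinct tangents, `m ≥ 1`
    ((∀ m : ℕ, 1 ≤ m →
        PlaneCurve.IsIsolatedSingularity (PlaneCurve.transversalFamily m) ∧
        PlaneCurve.HasSmoothTransversalBranches (PlaneCurve.transversalFamily m) ∧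
        FiniteDimensional ℂ (PlaneCurve.MilnorAlgebra (PlaneCurve.transversalFamily m)) ∧
        FiniteDimensional ℂ (PlaneCurve.TjurinaAlgebra (PlaneCurve.transversalFamily m)) ∧
        PlaneCurve.milnorNumber (PlaneCurve.transversalFamily m) = 4 * m ^ 2 ∧
        (PlaneCurve.tjurinaNumber (PlaneCurve.transversalFamily m) : ℤ)
          = 4 * (m : ℤ) ^ 2 - ((m : ℤ) - 1) ^ 2) ∧
      StrictMonoOn (fun m : ℕ => PlaneCurve.rho (PlaneCurve.transversalFamily m)) (Set.Ici 1) ∧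
      Tendsto (fun m : ℕ => (PlaneCurve.rho (PlaneCurve.transversalFamily m) : ℝ))
        atTop (𝓝 (4 / 3))) := by
  refine ⟨⟨fun k => PlaneCurve.irreducibleFamily (k + 2), fun k => ?_, fun i j hij => ?_,
      PlaneCurve.tendsto_rho_irreducibleFamily.comp (tendsto_add_atTop_nat 2)⟩,
    ⟨fun m hm => ?_, PlaneCurve.strictMonoOn_rho_irreducibleFamily,
      PlaneCurve.tendsto_rho_irreducibleFamily⟩,
    ⟨fun m hm => ?_, PlaneCurve.strictMonoOn_rho_transversalFamily,
      PlaneCurve.tendsto_rho_transversalFamily⟩⟩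
  · have hk : 2 ≤ k + 2 := Nat.le_add_left 2 k
    exact ⟨PlaneCurve.isIsolatedSingularity_irreducibleFamily hk,
      PlaneCurve.finiteDimensional_milnorAlgebra_irreducibleFamily hk,
      PlaneCurve.finiteDimensional_tjurinaAlgebra_irreducibleFamily hk⟩
  · exact PlaneCurve.strictMonoOn_rho_irreducibleFamily (Nat.le_add_left 2 i)
      (Nat.le_add_left 2 j) (Nat.add_lt_add_right hij 2)
  · exact ⟨PlaneCurve.isIsolatedSingularity_irreducibleFamily hm,
      PlaneCurve.irreducible_irreducibleFamily (one_le_two.trans hm),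
      PlaneCurve.finiteDimensional_milnorAlgebra_irreducibleFamily hm,
      PlaneCurve.finiteDimensional_tjurinaAlgebra_irreducibleFamily hm,
      PlaneCurve.tjurinaNumber_irreducibleFamily hm, PlaneCurve.milnorNumber_irreducibleFamily hm⟩
  · exact ⟨PlaneCurve.isIsolatedSingularity_transversalFamily hm,
      PlaneCurve.hasSmoothTransversalBranches_transversalFamily hm,
      PlaneCurve.finiteDimensional_milnorAlgebra_transversalFamily hm,
      PlaneCurve.finiteDimensional_tjurinaAlgebra_transversalFamily hm,
      PlaneCurve.milnorNumber_transversalFamily hm, PlaneCurve.tjurinaNumber_transversalFamily hm⟩
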